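/- Let $\Omega\subset\mathbb{R}^2$ be a bounded, simply connected open set. A *quantized measured foliation* of $\Omega$ consists of a finite set of defects $D=\{p_1,\dots,p_m\}\subset\Omega$ with non-negative integers $n_1,\dots,n_m$, and a cover of $\Omega\setminus D$ by open sets $U_\alpha$ with smooth diffeomorphisms $\varphi_\alpha$ from $U_\alpha$ onto open subsets of $\mathbb{R}^2$, such that the transition functions $\varphi_\alpha\circ\varphi_\beta^{-1}$ have the form $(x_1,x_2)\mapsto(f_{\alpha\beta}(x_1,x_2),\,2k_{\alpha\beta}\pi+\epsilon_{\alpha\beta}x_2)$ with $k_{\alpha\beta}\in\mathbb{Z}$, $\epsilon_{\alpha\beta}\in\{\pm1\}$, and such that each $p_j$ is in the closure of exactly $n_j$ leaves. A *phase function* is a Lipschitz function $\theta:\bar\Omega\to\mathbb{R}$ such that, with $\Gamma_D=\{x\in\bar\Omega:\sin\theta(x)=0\}$, 1. the level curves of $\theta$ form a quantized measured foliation with defects on $\Gamma_D$: there is a quantized measured foliation of $\Omega$ with $D\subset\Gamma_D$ such that in every chart $\cos x_2=\cos\theta$ (equivalently, at each point $x_2=\pm\theta+2n\pi$ for some $n\in\mathbb{Z}$);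 2. each connected component $S$ of $\Omega\setminus\Gamma_D$ is an annular strip: there is a homeomorphism $S^1\times(-1,1)\to S$ which extends to a Lipschitz map $S^1\times[-1,1]\to\bar S$ that maps $S^1\times\{\pm1\}$ into $\{\cos\theta=\pm1\}$. For $p\in\Omega\setminus\Gamma_D$ the *induced orientation* is $o_\theta(p)=\mathrm{sgn}(n_p\cdot\nabla\theta(p))$, where $\gamma$ is the level curve of $\theta$ through $p$ (the connected component containing $p$ of the level set of $\theta$ in $\Omega$) and $n_p$ is the unit normal to $\gamma$ at $p$ that points into the bounded component of $\mathbb{R}^2\setminus\gamma$. **Theorem 2.5.** Let $\theta$ be a phase function with $\theta=0$ on $\partial\Omega$. Then $\Omega\setminus\Gamma_D$ has finitely many connected components $S_1,\dots,S_k$, and for every $\epsilon:\{1,\dots,k\}\to\{-1,1\}$ there is a phase function $\theta^\epsilon:\bar\Omega\to\mathbb{R}$ that is gauge-equivalent to $\theta$ (that is, $\cos\theta^\epsilon=\cos\theta$ on $\bar\Omega$), satisfies $\theta^\epsilon=0$ on $\partial\Omega$, and has $o_{\theta^\epsilon}(p)=\epsilon(i)$ for every $p\in S_i$ and every $i$.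 In particular, there is such a phase function with $o=1$ on all of $\Omega\setminus\Gamma_D$. -/

import Mathlib

open scoped ContDiff

/-- The Euclidean plane. -/
abbrev Plane : Type := EuclideanSpace ℝ (Fin 2)

/-! ### Measured foliations -/

/-- `p` and `q` lie on a common plaque: some chart `e` contains both, and they lie in the same
connected component of a level set `{x₂ = c}` of the second coordinate of that chart. -/
def SamePlaque (charts : Set (OpenPartialHomeomorph Plane (ℝ × ℝ))) (p q : Plane) : Prop :=
  ∃ e ∈ charts, p ∈ e.source ∧
    q ∈ connectedComponentIn {x | x ∈ e.source ∧ (e x).2 = (e p).2} p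

/-- The leaf through `p`: all the points that can be reached from `p` by a finite chain of
plaques. -/
def leafThrough (charts : Set (OpenPartialHomeomorph Plane (ℝ × ℝ))) (p : Plane) : Set Plane :=
  {q | Relation.ReflTransGen (SamePlaque charts) p q}

/-- The leaves of the foliation given by a family of charts. -/
def foliationLeaves (charts : Set (OpenPartialHomeomorph Plane (ℝ × ℝ))) : Set (Set Plane) :=
  {L | ∃ e ∈ charts, ∃ p ∈ e.source, L = leafThrough charts p}

/-- A measured foliation of `Ω` with finitely many defects `pᵢ` and indices `nᵢ`: a cover of
`Ω` minus the defects by open sets, each with a diffeomorphism onto an open subset of `ℝ²`, such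
that the second coordinates of any two charts are related by `x₂ ↦ c ± x₂` on their overlap, and
such that each defect `pᵢ` is in the closure of exactly `nᵢ` leaves. -/
structure MeasuredFoliation (Ω : Set Plane) where
  defects : Finset Plane
  defects_subset : (defects : Set Plane) ⊆ Ω
  index : Plane → ℕ
  charts : Set (OpenPartialHomeomorph Plane (ℝ × ℝ))
  smooth : ∀ e ∈ charts, ContDiffOn ℝ ∞ e e.source
  smooth_symm : ∀ e ∈ charts, ContDiffOn ℝ ∞ e.symm e.target
  cover : (⋃ e ∈ charts, e.source) = Ω \ (defects : Set Plane)
  overlap : ∀ e ∈ charts, ∀ e' ∈ charts, ∃ (c : ℝ) (s : ℤˣ),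
    ∀ p ∈ e.source ∩ e'.source, (e p).2 = c + ((s : ℤ) : ℝ) * (e' p).2
  index_eq : ∀ p ∈ defects, {L ∈ foliationLeaves charts | p ∈ closure L}.encard = index p

/-- The foliation is quantized: on overlaps the second coordinates are related by
`x₂ ↦ 2kπ ± x₂` with an integer `k`. -/
def MeasuredFoliation.IsQuantized {Ω : Set Plane} (F : MeasuredFoliation Ω) : Prop :=
  ∀ e ∈ F.charts, ∀ e' ∈ F.charts, ∃ (k : ℤ) (s : ℤˣ),
    ∀ p ∈ e.source ∩ e'.source, (e p).2 = 2 * (k : ℝ) * Real.pi + ((s : ℤ) : ℝ) * (e' p).2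

/-! ### Phase functions -/

/-- The set `Γ_D` on which `sin θ = 0`, i.e. the union of the level sets `cos θ = ±1`. -/
def phaseZeroSet (Ω : Set Plane) (θ : Plane → ℝ) : Set Plane :=
  {x | x ∈ closure Ω ∧ Real.sin (θ x) = 0}

/-- The strips: the connected components of `Ω` minus the set `{sin θ = 0}`. -/
def phaseStrips (Ω : Set Plane) (θ : Plane → ℝ) : Set (Set Plane) :=
  {S | ∃ p ∈ Ω \ phaseZeroSet Ω θ, S = connectedComponentIn (Ω \ phaseZeroSet Ω θ) p}

/-- `S` is annular: there is a homeomorphism from `S¹ × (-1, 1)` to `S` that extends to a Lipschitz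
map on `S¹ × [-1, 1]` which sends `S¹ × {1}` into `{cos θ = 1}` and `S¹ × {-1}` into
`{cos θ = -1}`. The values of `ψ` outside `S¹ × [-1, 1]` are irrelevant. -/
def IsAnnularStrip (Ω : Set Plane) (θ : Plane → ℝ) (S : Set Plane) : Prop :=
  ∃ (Φ : (Circle × Set.Ioo (-1 : ℝ) 1) ≃ₜ S) (ψ : Circle × ℝ → Plane),
    (∃ K : NNReal, LipschitzOnWith K ψ (Set.univ ×ˢ Set.Icc (-1 : ℝ) 1)) ∧
    (∀ (z : Circle) (t : Set.Ioo (-1 : ℝ) 1), ψ (z, (t : ℝ)) = (Φ (z, t) : Plane)) ∧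
    (∀ z : Circle, ψ (z, 1) ∈ closure Ω ∧ Real.cos (θ (ψ (z, 1))) = 1) ∧
    (∀ z : Circle, ψ (z, -1) ∈ closure Ω ∧ Real.cos (θ (ψ (z, -1))) = -1)

/-- `θ` is a (Lipschitz) phase function on the closure of `Ω`: it is Lipschitz there; its level
curves form a quantized measured foliation, i.e. there is a quantized measured foliation whose
local phases (the second coordinates `x₂` of the charts) represent `θ` up to `θ ↦ ±θ + 2nπ`, that
is `cos x₂ = cos θ`, all of whose defects lie on `{sin θ = 0}`; and the components of `Ω` minus
`{sin θ = 0}` are annular strips. Values of `θ` outside the closure of `Ω` are irrelevant. -/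
structure IsPhaseFunction (Ω : Set Plane) (θ : Plane → ℝ) : Prop where
  lipschitz : ∃ K : NNReal, LipschitzOnWith K θ (closure Ω)
  foliation : ∃ F : MeasuredFoliation Ω, F.IsQuantized ∧
    (∀ e ∈ F.charts, ∀ p ∈ e.source, Real.cos (e p).2 = Real.cos (θ p)) ∧
    (F.defects : Set Plane) ⊆ phaseZeroSet Ω θ
  annular : ∀ S ∈ phaseStrips Ω θ, IsAnnularStrip Ω θ S

/-- The Dirichlet condition `θ = 0` on the boundary of `Ω`. -/
def DirichletCondition (Ω : Set Plane) (θ : Plane → ℝ) : Prop :=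
  ∀ x ∈ frontier Ω, θ x = 0

/-- Two phases are gauge-equivalent when they have the same height field `cos θ`. -/
def GaugeEquivalent (Ω : Set Plane) (θ₁ θ₂ : Plane → ℝ) : Prop :=
  ∀ x ∈ closure Ω, Real.cos (θ₁ x) = Real.cos (θ₂ x)

/-! ### The induced orientation -/

/-- The level curve of `θ` through `p`: the component containing `p` of the level set of `θ`
in `Ω`. -/
def levelCurve (Ω : Set Plane) (θ : Plane → ℝ) (p : Plane) : Set Plane :=
  connectedComponentIn {q | q ∈ Ω ∧ θ q = θ p} p

/-- The inside of a curve `γ`: the union of the bounded components of the complement of `γ`. For a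
Jordan curve there is exactly one bounded component. -/
def insideOf (γ : Set Plane) : Set Plane :=
  {q | q ∉ γ ∧ Bornology.IsBounded (connectedComponentIn γᶜ q)}

/-- `n` is an inner unit normal of the curve `γ` at `p`: a unit vector that is orthogonal to all
tangent vectors of `γ` at `p` and points to the inside of `γ`. -/
def IsInnerNormal (γ : Set Plane) (p n : Plane) : Prop :=
  ‖n‖ = 1 ∧ (∀ v ∈ tangentConeAt ℝ γ p, inner ℝ n v = 0) ∧
    ∀ᶠ s : ℝ in nhdsWithin 0 (Set.Ioi 0), p + s • n ∈ insideOf γ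

open Classical in
/-- The inner unit normal of `γ` at `p`, or the zero vector if there is none. -/
noncomputable def innerNormal (γ : Set Plane) (p : Plane) : Plane :=
  if h : ∃ n, IsInnerNormal γ p n then h.choose else 0

/-- The induced orientation `o_θ(p) = sgn (n_p · ∇θ(p))`, with `n_p` the inner normal at `p` of the
level curve of `θ` through `p`. If there is no inner normal, or if `θ` is not differentiable at
`p`, then the value is `0`; so a value `±1` includes that both exist. -/
noncomputable def inducedOrientation (Ω : Set Plane) (θ : Plane → ℝ) (p : Plane) : ℤ :=
  (SignType.sign (inner ℝ (innerNormal (levelCurve Ω θ p) p) (gradient θ p)) : ℤ)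

open Set Filter Topology

/-! For a strip `S`, `sin θ = 0` on its frontier, so the map equal to `exp(2iθ)` on `S` and to `1`
off `S` is continuous from the plane to the circle. Half of a real lift, normalised at infinity, is
the potential `g S` (`exists_isStripPotential`): it is `θ` plus a constant in `πℤ` on `S` and is
`πℤ`-valued off `S`. Subtracting `2 * g S` from `θ` therefore reflects `θ` on `S` up to `2πℤ` and
changes it by a multiple of `2π` elsewhere. So `cos θ` is kept, and strips can be flipped
independently. The change is Lipschitz, and it vanishes off `Ω` because `Ω` has no holes
(`eq_zero_of_notMem_of_isSimplyConnected`), which keeps the boundary condition.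

The orientation of `S` is the sign of `g S`. If `g S > 0` on `S`, its values there lie in `(0, π)`,
and a level set `{g = c}` with `c` in that range lies in `S`. Since `θ` has no critical points on
`S`, the annular parametrisation makes the parts of `S` below and above `c` connected
(`isPreconnected_sublevel_of_annulus`). A winding argument then makes the level set connected
(`isPreconnected_level_of_closure`), so it is the level curve of `θ`. As `g` vanishes at infinity,
the curve encloses the points with `g > c`, while nearby points with `g < c` lie in the unbounded
component. Thus `θ` increases inwards.

There are finitely many strips because the Lipschitz bound forces each to contain a ball of fixed
radius. -/

/-! ### Circle-valued lifts and connectedness -/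

theorem exists_continuous_circle_lift {u : Plane → Circle} (hu : Continuous u) :
    ∃ G : Plane → ℝ, Continuous G ∧ ∀ x, Circle.exp (G x) = u x := by
  obtain ⟨F, ⟨-, hF⟩, -⟩ := Circle.isCoveringMap_exp.existsUnique_continuousMap_lifts
    (⟨u, hu⟩ : C(Plane, Circle)) 0 (Complex.arg (u 0)) (by simp)
  exact ⟨F, F.continuous, fun x ↦ congrFun hF x⟩

theorem isPreconnected_setOf_le_norm {R : ℝ} (hR : 0 < R) :
    IsPreconnected {x : Plane | R ≤ ‖x‖} := by
  have hrank : 1 < Module.rank ℝ Plane := by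
    rw [← Module.finrank_eq_rank, finrank_euclideanSpace_fin]; norm_num
  have h0 := (isConnected_compl_singleton_of_one_lt_rank hrank (0 : Plane)).isPreconnected
  have h := h0.image (fun x : Plane ↦ (max ‖x‖ R / ‖x‖) • x) (by
      have hn : ContinuousOn (fun x : Plane ↦ ‖x‖) {0}ᶜ := continuous_norm.continuousOn
      have hm : ContinuousOn (fun x : Plane ↦ max ‖x‖ R) {0}ᶜ :=
        (continuous_norm.max continuous_const).continuousOn
      exact (hm.div hn fun x hx ↦ by simpa using hx).smul continuousOn_id)
  convert h using 1
  ext x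
  simp only [mem_ofPred_eq, mem_image, mem_compl_iff, mem_singleton_iff]
  constructor
  · intro hx
    have hx0 : 0 < ‖x‖ := hR.trans_le hx
    refine ⟨x, norm_pos_iff.1 hx0, ?_⟩
    rw [max_eq_left hx, div_self hx0.ne', one_smul]
  · rintro ⟨y, hy, rfl⟩
    have hy0 : 0 < ‖y‖ := norm_pos_iff.2 hy
    rw [norm_smul, Real.norm_of_nonneg (by positivity), div_mul_cancel₀ _ hy0.ne']
    exact le_max_right _ _

theorem IsPreconnected.eq_of_forall_int_mul {X : Type*} [TopologicalSpace X] {s : Set X}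
    (hs : IsPreconnected s) {f : X → ℝ} (hf : ContinuousOn f s) {P : ℝ} (hP : 0 < P)
    (hval : ∀ x ∈ s, ∃ n : ℤ, f x = n * P) {x y : X} (hx : x ∈ s) (hy : y ∈ s) : f x = f y := by
  wlog hlt : f x < f y generalizing x y
  · rcases lt_trichotomy (f x) (f y) with h | h | h
    · exact this hx hy h
    · exact h
    · exact (this hy hx h).symm
  exfalso
  obtain ⟨n, hn⟩ := hval x hx
  obtain ⟨m, hm⟩ := hval y hy
  have hnm : n < m := by
    rw [hn, hm] at hlt
    exact_mod_cast lt_of_mul_lt_mul_right hlt hP.le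
  have hnm' : (n : ℝ) + 1 ≤ m := by exact_mod_cast hnm
  obtain ⟨z, hz, hfz⟩ := hs.intermediate_value hx hy hf
    (show f x + P / 2 ∈ Icc (f x) (f y) by constructor <;> [linarith; (rw [hn, hm]; nlinarith)])
  obtain ⟨k, hk⟩ := hval z hz
  have h2 : (k : ℝ) * P * 2 = (2 * n + 1) * P := by rw [← hk, hfz, hn]; ring
  have h3 : (2 * k : ℝ) = 2 * n + 1 := by
    apply mul_right_cancel₀ hP.ne'; linarith
  have : 2 * k = 2 * n + 1 := by exact_mod_cast h3
  omega

theorem IsPreconnected.inter_frontier_nonempty {X : Type*} [TopologicalSpace X] {s t : Set X}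
    (ht : IsPreconnected t) (hs : (t ∩ s).Nonempty) (hs' : (t ∩ sᶜ).Nonempty) :
    (t ∩ frontier s).Nonempty := by
  by_contra hempty
  rw [not_nonempty_iff_eq_empty, ← disjoint_iff_inter_eq_empty, Set.disjoint_left] at hempty
  obtain ⟨x, hxt, hxs⟩ := hs
  obtain ⟨y, hyt, hys⟩ := hs'
  obtain ⟨z, -, hz, hz'⟩ := ht (interior s) (closure s)ᶜ isOpen_interior
    isClosed_closure.isOpen_compl
    (fun w hw ↦ by
      by_cases h : w ∈ interior s
      · exact Or.inl h
      · exact Or.inr fun hc ↦ hempty hw ⟨hc, h⟩)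
    ⟨x, hxt, by_contra fun h ↦ hempty hxt ⟨subset_closure hxs, h⟩⟩
    ⟨y, hyt, fun hc ↦ hempty hyt ⟨hc, fun h ↦ hys (interior_subset h)⟩⟩
  exact hz' (subset_closure (interior_subset hz))

theorem Continuous.eq_of_mem_closure_of_mem_open {X : Type*} [TopologicalSpace X] {F : X → ℝ}
    (hF : Continuous F) {A N : Set X} (hN : IsOpen N) {m : ℝ} (h : ∀ x ∈ A, x ∈ N → F x = m)
    {p : X} (hpA : p ∈ closure A) (hpN : p ∈ N) : F p = m := by
  have hp : p ∈ closure (A ∩ N) := mem_closure_iff.2 fun o ho hpo ↦ by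
    obtain ⟨y, ⟨hyo, hyN⟩, hyA⟩ := mem_closure_iff.1 hpA _ (ho.inter hN) ⟨hpo, hpN⟩
    exact ⟨y, hyo, hyA, hyN⟩
  exact closure_minimal (t := {x | F x = m}) (fun x hx ↦ h x hx.1 hx.2)
    (isClosed_eq hF continuous_const) hp

/-! ### Connectedness of level sets -/

/-- A level set of a function on the plane is preconnected if it is bounded and all its points are
limits of one preconnected part of the sublevel set, and of one preconnected part of the superlevel
set. -/
theorem isPreconnected_level_of_closure {g : Plane → ℝ} (hg : Continuous g) {c : ℝ}
    (hbdd : Bornology.IsBounded {x | g x = c}) {A B : Set Plane}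
    (hA : IsPreconnected A) (hAg : ∀ x ∈ A, g x < c) (hcA : {x | g x = c} ⊆ closure A)
    (hB : IsPreconnected B) (hBg : ∀ x ∈ B, c < g x) (hcB : {x | g x = c} ⊆ closure B) :
    IsPreconnected {x | g x = c} := by
  have hLc : IsClosed {x | g x = c} := isClosed_eq hg continuous_const
  rw [isPreconnected_closed_iff]
  rintro t t' ht ht' hsub ⟨p, hp, hpt⟩ ⟨q, hq, hqt⟩
  by_contra hempty
  rw [not_nonempty_iff_eq_empty] at hempty
  have hnot : ∀ x, g x = c → x ∈ t → x ∉ t' := fun x h1 h2 h3 ↦ by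
    have : x ∈ {x | g x = c} ∩ (t ∩ t') := ⟨h1, h2, h3⟩
    rw [hempty] at this; exact this
  obtain ⟨R, hR⟩ := hbdd.subset_ball 0
  obtain ⟨N, hNo, hKN, hNcl⟩ := normal_exists_closure_subset (hLc.inter ht)
    ((hLc.inter ht').isOpen_compl.inter (Metric.isOpen_ball (x := (0 : Plane)) (ε := R)))
    -- `N` is a bounded neighbourhood of the piece in `t` whose closure misses the piece in `t'`;
    -- hence `g ≠ c` on its frontier.
    (fun x hx ↦ ⟨fun h ↦ hnot x hx.1 hx.2 h.2, hR hx.1⟩)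
  have hfr : IsCompact (frontier N) :=
    Metric.isCompact_of_isClosed_isBounded isClosed_frontier
      (Metric.isBounded_ball.subset fun x hx ↦ (hNcl hx.1).2)
  obtain ⟨δ, hδ, hδle⟩ := hfr.exists_forall_le' (f := fun x ↦ |g x - c|) (by fun_prop) (a := 0)
    (fun x hx ↦ abs_pos.2 fun h ↦ by
      have hgx : g x = c := sub_eq_zero.1 h
      rcases hsub hgx with h | h
      · exact (hNo.frontier_eq ▸ hx).2 (hKN ⟨hgx, h⟩)
      · exact (hNcl hx.1).1 ⟨hgx, h⟩)
  -- A ramp from `0` to `1` across `[c - δ, c + δ]`. On `frontier N` it takes only the values `0`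
  -- and `1`, so `exp(2πi h(g))` on `N` glues continuously to `1` outside.
  set h : ℝ → ℝ := fun y ↦ max 0 (min 1 ((y - c + δ) / (2 * δ))) with hh
  have hcont : Continuous h := by fun_prop
  have h0 : ∀ y, y ≤ c - δ → h y = 0 := fun y hy ↦ by
    apply max_eq_left
    exact (min_le_right _ _).trans (div_nonpos_of_nonpos_of_nonneg (by linarith) (by positivity))
  have h1 : ∀ y, c + δ ≤ y → h y = 1 := fun y hy ↦ by
    have : 1 ≤ (y - c + δ) / (2 * δ) := by rw [le_div_iff₀ (by positivity)]; linarith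
    simp [hh, min_eq_left this]
  have hlo : ∀ x ∈ frontier N, g x < c → h (g x) = 0 := fun x hx hlt ↦ h0 _ (by
    have := hδle x hx
    rw [abs_of_neg (by linarith)] at this; linarith)
  have hhi : ∀ x ∈ frontier N, c < g x → h (g x) = 1 := fun x hx hlt ↦ h1 _ (by
    have := hδle x hx
    rw [abs_of_pos (by linarith)] at this; linarith)
  classical
  obtain ⟨G, hG, hGu⟩ := exists_continuous_circle_lift
    (u := N.piecewise (fun x ↦ Circle.exp (2 * Real.pi * h (g x))) (fun _ ↦ 1)) (by
      refine Continuous.piecewise (fun x hx ↦ ?_) (by fun_prop) continuous_const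
      rcases lt_trichotomy (g x) c with hlt | heq | hlt
      · rw [hlo x hx hlt]; simp
      · have := hδle x hx
        simp only [heq, sub_self, abs_zero] at this
        linarith
      · rw [hhi x hx hlt]; simp)
  have hGN : ∀ x ∈ N, ∃ k : ℤ, G x = 2 * Real.pi * h (g x) + k * (2 * Real.pi) := fun x hx ↦ by
    have := hGu x
    rw [piecewise_eq_of_mem _ _ _ hx] at this
    exact Circle.exp_eq_exp.1 this
  have hGN' : ∀ x ∉ N, ∃ k : ℤ, G x = k * (2 * Real.pi) := fun x hx ↦ by
    have := hGu x
    rw [piecewise_eq_of_notMem _ _ _ hx] at this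
    exact Circle.exp_eq_one.1 this
  -- off the level set, `G` agrees up to a constant with an explicit function on either side
  have key : ∀ (C : Set Plane) (e : ℤ), IsPreconnected C →
      (∀ x ∈ C, x ∈ frontier N → h (g x) = e) → (p ∈ closure C) → (q ∈ closure C) →
      G p - 2 * Real.pi * (h (g p) - e) = G q := by
    intro C e hC hCe hpC hqC
    obtain ⟨x₀, hx₀⟩ : C.Nonempty := closure_nonempty_iff.1 ⟨p, hpC⟩
    set w : Plane → ℝ := N.piecewise (fun x ↦ 2 * Real.pi * (h (g x) - e)) (fun _ ↦ 0) with hw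
    have hwc : ContinuousOn w C := by
      refine ContinuousOn.piecewise (fun x hx ↦ ?_) (by fun_prop) continuousOn_const
      rw [hCe x hx.1 hx.2]; simp
    have hconst : ∀ x ∈ C, G x - w x = G x₀ - w x₀ := fun x hx ↦ by
      refine hC.eq_of_forall_int_mul (hG.continuousOn.sub hwc) Real.two_pi_pos (fun y hy ↦ ?_) hx hx₀
      by_cases hyN : y ∈ N
      · obtain ⟨k, hk⟩ := hGN y hyN
        refine ⟨k + e, ?_⟩
        simp only [hw, Pi.sub_apply, piecewise_eq_of_mem _ _ _ hyN, hk]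
        push_cast; ring
      · obtain ⟨k, hk⟩ := hGN' y hyN
        exact ⟨k, by simp only [hw, Pi.sub_apply, piecewise_eq_of_notMem _ _ _ hyN, hk, sub_zero]⟩
    have e1 : G p - 2 * Real.pi * (h (g p) - e) = G x₀ - w x₀ := by
      refine Continuous.eq_of_mem_closure_of_mem_open
        (F := fun x ↦ G x - 2 * Real.pi * (h (g x) - e)) (by fun_prop) hNo (fun x hx hxN ↦ ?_) hpC
        (hKN ⟨hp, hpt⟩)
      rw [← hconst x hx, hw, piecewise_eq_of_mem _ _ _ hxN]
    have e2 : G q = G x₀ - w x₀ := by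
      refine hG.eq_of_mem_closure_of_mem_open isClosed_closure.isOpen_compl (fun x hx hxN ↦ ?_) hqC
        (fun hqN ↦ (hNcl hqN).1 ⟨hq, hqt⟩)
      rw [← hconst x hx, hw, piecewise_eq_of_notMem _ _ _ fun h ↦ hxN (subset_closure h), sub_zero]
    rw [e1, e2]
  -- Going from `p` to `q` below the level and above it gives values of `G p - G q` that differ by
  -- `2π`.
  have k1 := key A 0 hA (fun x hx hxf ↦ by simpa using hlo x hxf (hAg x hx)) (hcA hp) (hcA hq)
  have k2 := key B 1 hB (fun x hx hxf ↦ by simpa using hhi x hxf (hBg x hx)) (hcB hp) (hcB hq)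
  push_cast at k1 k2
  have := Real.pi_pos
  linarith

/-! ### Vanishing off a simply connected set -/

/-- A continuous function on the plane that vanishes near infinity and only takes values in `πℤ`
off a simply connected open set `Ω` vanishes off `Ω`. -/
theorem eq_zero_of_notMem_of_isSimplyConnected {Ω : Set Plane} (hΩo : IsOpen Ω)
    (hΩ : IsSimplyConnected Ω) {g : Plane → ℝ} (hg : Continuous g) {R : ℝ}
    (hfar : ∀ x, R ≤ ‖x‖ → g x = 0) (hval : ∀ x ∉ Ω, ∃ n : ℤ, g x = n * Real.pi)
    {x₀ : Plane} (hx₀ : x₀ ∉ Ω) : g x₀ = 0 := by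
  classical
  have hπ := Real.pi_pos
  have habs : ∀ x ∉ Ω, g x ≠ 0 → Real.pi ≤ |g x| := fun x hx hne ↦ by
    obtain ⟨n, hn⟩ := hval x hx
    have hn0 : n ≠ 0 := by rintro rfl; simp [hn] at hne
    have : (1 : ℝ) ≤ |(n : ℝ)| := by exact_mod_cast Int.one_le_abs hn0
    rw [hn, abs_mul, abs_of_pos hπ]
    nlinarith
  by_contra hne
  have hx₀π := habs x₀ hx₀ hne
  -- The complex coordinate centred at `x₀`. Since `x₀ ∉ Ω`, it has a logarithm `α` on `Ω`; the aim
  -- is to deform it to a nowhere zero function on the whole plane without changing it near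
  -- infinity.
  set f : Plane → ℂ := fun x ↦ ((x 0 - x₀ 0 : ℝ) : ℂ) + ((x 1 - x₀ 1 : ℝ) : ℂ) * Complex.I with hf
  have hfc : Continuous f := by fun_prop
  have hf0 : ∀ x, f x = 0 → x = x₀ := fun x hx ↦ by
    have h1 := congrArg Complex.re hx
    have h2 := congrArg Complex.im hx
    simp [hf] at h1 h2
    ext i
    fin_cases i
    · simpa using sub_eq_zero.1 h1
    · simpa using sub_eq_zero.1 h2
  obtain ⟨α, hαc, hα⟩ := Complex.exists_continuousOn_eqOn_exp_comp hΩ hΩo hfc.continuousOn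
    (by rintro ⟨x, hx, hfx⟩; exact hx₀ (hf0 x hfx ▸ hx))
  have hα' : ∀ x ∈ Ω, Complex.exp (α x) = f x := fun x hx ↦ hα hx
  set χ : ℝ → ℝ := fun y ↦ max 0 (min 1 (2 - 4 * |y| / Real.pi)) with hχ
  have hχc : Continuous χ := by fun_prop
  have hχ1 : ∀ y, |y| < Real.pi / 4 → χ y = 1 := fun y hy ↦ by
    have : 1 ≤ 2 - 4 * |y| / Real.pi := by
      rw [le_sub_comm, div_le_iff₀ hπ]; linarith
    simp [hχ, min_eq_left this]
  have hχ0 : ∀ y, Real.pi / 2 < |y| → χ y = 0 := fun y hy ↦ by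
    refine max_eq_left ((min_le_right _ _).trans ?_)
    rw [sub_nonpos, le_div_iff₀ hπ]; linarith
  -- The cutoff turns `exp α = f` into `1` as `|g|` grows from `π/4` to `π/2`. Off `Ω` the values of
  -- `|g|` are `0` or at least `π`, so no intermediate value of the cutoff occurs there. At `x₀`,
  -- the only zero of `f`, `H` is `1`.
  set H : Plane → ℂ := fun x ↦ if x ∈ Ω then Complex.exp (χ (g x) * α x) else
    if |g x| < Real.pi / 4 then f x else 1 with hH
  have hHf : ∀ x, |g x| < Real.pi / 4 → H x = f x := fun x hx ↦ by
    by_cases hxΩ : x ∈ Ω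
    · simp [hH, hxΩ, hχ1 _ hx, hα' x hxΩ]
    · simp [hH, hxΩ, hx]
  have hH1 : ∀ x, Real.pi / 2 < |g x| → H x = 1 := fun x hx ↦ by
    by_cases hxΩ : x ∈ Ω
    · simp [hH, hxΩ, hχ0 _ hx]
    · have : ¬ |g x| < Real.pi / 4 := by linarith
      simp only [hH, if_neg hxΩ, if_neg this]
  have hHc : Continuous H := by
    rw [continuous_iff_continuousAt]
    intro x
    by_cases hxΩ : x ∈ Ω
    · have : ContinuousOn (fun x ↦ Complex.exp (χ (g x) * α x)) Ω := by
        refine Complex.continuous_exp.comp_continuousOn (ContinuousOn.mul ?_ hαc)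
        exact (Complex.continuous_ofReal.comp (hχc.comp hg)).continuousOn
      refine (this.continuousAt (hΩo.mem_nhds hxΩ)).congr ?_
      filter_upwards [hΩo.mem_nhds hxΩ] with y hy
      simp [hH, hy]
    · by_cases hgx : g x = 0
      · refine hfc.continuousAt.congr ?_
        filter_upwards [(isOpen_lt hg.abs continuous_const).mem_nhds
          (show |g x| < Real.pi / 4 by simp [hgx]; positivity)] with y hy
        exact (hHf y hy).symm
      · refine (continuousAt_const (y := (1 : ℂ))).congr ?_
        filter_upwards [(isOpen_lt continuous_const hg.abs).mem_nhds
          (show Real.pi / 2 < |g x| by linarith [habs x hxΩ hgx])] with y hy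
        exact (hH1 y hy).symm
  have hH0 : ∀ x, H x ≠ 0 := fun x ↦ by
    by_cases hx : |g x| < Real.pi / 4
    · rw [hHf x hx]
      intro h
      rw [hf0 x h] at hx
      linarith
    · by_cases hxΩ : x ∈ Ω
      · simp only [hH, if_pos hxΩ]; exact Complex.exp_ne_zero _
      · simp [hH, hxΩ, hx]
  obtain ⟨β, hβc, hβ⟩ := Complex.exists_continuousOn_eqOn_exp_comp (U := (univ : Set Plane))
    (by
      rw [IsSimplyConnected]
      exact (Homeomorph.Set.univ Plane).toHomotopyEquiv.simplyConnectedSpace)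
    isOpen_univ hHc.continuousOn (by rintro ⟨x, -, hx⟩; exact hH0 x hx)
  have hβ' : ∀ x, R ≤ ‖x‖ → Complex.exp (β x) = f x := fun x hx ↦ by
    rw [← hHf x (by rw [hfar x hx]; simpa using by positivity)]
    exact hβ (mem_univ x)
  -- Large enough for the circle about `x₀` to stay where `H = f`. The global logarithm `β` of `H`
  -- would give `f` winding number zero on this circle, but the winding number is one.
  set ρ : ℝ := |R| + ‖x₀‖ + 1 with hρ
  have hρ0 : 0 < ρ := by positivity
  set γ : ℝ → Plane := fun t ↦ x₀ + ρ • !₂[Real.cos t, Real.sin t] with hγ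
  have hγc : Continuous γ := by
    have h1 : Continuous fun t : ℝ ↦ (!₂[Real.cos t, Real.sin t] : Plane) := by
      refine (PiLp.continuous_toLp 2 _).comp (continuous_pi fun i ↦ ?_)
      fin_cases i
      · exact Real.continuous_cos
      · exact Real.continuous_sin
    exact continuous_const.add (h1.const_smul ρ)
  have hγR : ∀ t, R ≤ ‖γ t‖ := fun t ↦ by
    have h1 : ‖(!₂[Real.cos t, Real.sin t] : Plane)‖ = 1 := by
      simp [EuclideanSpace.norm_eq]
    have h2 : ‖ρ • (!₂[Real.cos t, Real.sin t] : Plane)‖ ≤ ‖γ t‖ + ‖x₀‖ := by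
      have : ρ • (!₂[Real.cos t, Real.sin t] : Plane) = γ t - x₀ := by simp [hγ]
      rw [this]; exact norm_sub_le _ _
    rw [norm_smul, h1, Real.norm_of_nonneg hρ0.le, hρ] at h2
    linarith [le_abs_self R]
  have hfγ : ∀ t, f (γ t) = ρ * Complex.exp (t * Complex.I) := fun t ↦ by
    simp [hf, hγ, Complex.exp_mul_I]; ring
  have hk : ∀ t : ℝ, ∃ n : ℤ, (β (γ t)).im - t = n * (2 * Real.pi) := fun t ↦ by
    have h1 : Complex.exp (β (γ t) - t * Complex.I) = Complex.exp (Real.log ρ) := by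
      rw [Complex.exp_sub, hβ' _ (hγR t), hfγ, mul_div_cancel_right₀ _ (Complex.exp_ne_zero _),
        ← Complex.ofReal_exp, Real.exp_log hρ0]
    obtain ⟨n, hn⟩ := Complex.exp_eq_exp_iff_exists_int.1 h1
    refine ⟨n, ?_⟩
    have := congrArg Complex.im hn
    simpa using this
  have hcont : Continuous fun t : ℝ ↦ (β (γ t)).im - t := by
    refine (Complex.continuous_im.comp ?_).sub continuous_id
    exact (continuousOn_univ.1 hβc).comp hγc
  have := isPreconnected_univ.eq_of_forall_int_mul hcont.continuousOn Real.two_pi_pos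
    (fun t _ ↦ hk t) (mem_univ 0) (mem_univ (2 * Real.pi))
  have hγ0 : γ (2 * Real.pi) = γ 0 := by simp [hγ]
  simp only [hγ0] at this
  linarith

/-! ### Strip potentials -/

/-- A continuous function on the plane that differs from `θ` by a multiple of `π` on `S`, takes
values in `πℤ` off `S`, and vanishes near infinity. -/
structure IsStripPotential (S : Set Plane) (θ g : Plane → ℝ) : Prop where
  continuous : Continuous g
  exists_int_of_notMem : ∀ x ∉ S, ∃ n : ℤ, g x = n * Real.pi
  eq_on : ∃ a : ℤ, ∀ x ∈ S, g x = θ x - a * Real.pi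
  eventually_zero : ∃ R : ℝ, ∀ x, R ≤ ‖x‖ → g x = 0

theorem exists_isStripPotential {S : Set Plane} {θ : Plane → ℝ} (hS : IsPreconnected S)
    (hSb : Bornology.IsBounded S) (hθ : ContinuousOn θ (closure S))
    (hfr : ∀ x ∈ frontier S, Real.sin (θ x) = 0) : ∃ g, IsStripPotential S θ g := by
  classical
  obtain ⟨G, hG, hGu⟩ := exists_continuous_circle_lift
    (u := S.piecewise (fun x ↦ Circle.exp (2 * θ x)) (fun _ ↦ 1)) (by
      refine continuous_piecewise (fun x hx ↦ ?_) ?_ continuousOn_const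
      · obtain ⟨n, hn⟩ := Real.sin_eq_zero_iff.1 (hfr x hx)
        exact Circle.exp_eq_one.2 ⟨n, by rw [← hn]; ring⟩
      · exact Circle.exp.continuous.comp_continuousOn (continuousOn_const.mul hθ))
  have hGS : ∀ x ∈ S, ∃ k : ℤ, G x - 2 * θ x = k * (2 * Real.pi) := fun x hx ↦ by
    have := hGu x
    rw [piecewise_eq_of_mem _ _ _ hx] at this
    obtain ⟨k, hk⟩ := Circle.exp_eq_exp.1 this
    exact ⟨k, by rw [hk]; ring⟩
  have hGS' : ∀ x ∉ S, ∃ k : ℤ, G x = k * (2 * Real.pi) := fun x hx ↦ by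
    have := hGu x
    rw [piecewise_eq_of_notMem _ _ _ hx] at this
    exact Circle.exp_eq_one.1 this
  obtain ⟨R, hR0, hR⟩ := hSb.subset_ball_lt 0 0
  have hout : ∀ x : Plane, R ≤ ‖x‖ → x ∉ S := fun x hx hxS ↦ by
    have := hR hxS
    rw [mem_ball_zero_iff] at this
    linarith
  set z : Plane := EuclideanSpace.single 0 R
  have hz : R ≤ ‖z‖ := by simp [z, le_abs_self]
  obtain ⟨m, hm⟩ := hGS' z (hout z hz)
  -- The lift of `2θ` is determined modulo `2π`, so its half is determined modulo `π`; `m`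
  -- normalises it to vanish on the connected exterior of a ball.
  refine ⟨fun x ↦ G x / 2 - m * Real.pi, by fun_prop, fun x hx ↦ ?_, ?_, R, fun x hx ↦ ?_⟩
  · obtain ⟨k, hk⟩ := hGS' x hx
    exact ⟨k - m, by rw [hk]; push_cast; ring⟩
  · rcases S.eq_empty_or_nonempty with rfl | ⟨y, hy⟩
    · exact ⟨0, by simp⟩
    · obtain ⟨k, hk⟩ := hGS y hy
      refine ⟨m - k, fun x hx ↦ ?_⟩
      have := hS.eq_of_forall_int_mul (f := fun x ↦ G x - 2 * θ x)
        (hG.continuousOn.sub (continuousOn_const.mul (hθ.mono subset_closure))) Real.two_pi_pos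
        hGS hx hy
      simp only [hk] at this
      push_cast; linarith
  · have := (isPreconnected_setOf_le_norm hR0).eq_of_forall_int_mul hG.continuousOn
      Real.two_pi_pos (fun y hy ↦ hGS' y (hout y hy)) hx hz
    rw [this, hm]; ring

namespace IsStripPotential

variable {S : Set Plane} {θ g : Plane → ℝ}

theorem neg (h : IsStripPotential S θ g) :
    IsStripPotential S (fun x ↦ -θ x) (fun x ↦ -g x) where
  continuous := h.continuous.neg
  exists_int_of_notMem x hx := by
    obtain ⟨n, hn⟩ := h.exists_int_of_notMem x hx
    exact ⟨-n, by simp [hn]⟩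
  eq_on := by
    obtain ⟨a, ha⟩ := h.eq_on
    exact ⟨-a, fun x hx ↦ by rw [ha x hx]; push_cast; ring⟩
  eventually_zero := by
    obtain ⟨R, hR⟩ := h.eventually_zero
    exact ⟨R, fun x hx ↦ by simp [hR x hx]⟩

theorem congr_add_int (h : IsStripPotential S θ g) {θ' : Plane → ℝ} {m : ℤ}
    (hθ' : ∀ x ∈ S, θ' x = θ x + m * Real.pi) : IsStripPotential S θ' g where
  continuous := h.continuous
  exists_int_of_notMem := h.exists_int_of_notMem
  eq_on := by
    obtain ⟨a, ha⟩ := h.eq_on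
    exact ⟨a + m, fun x hx ↦ by rw [ha x hx, hθ' x hx]; push_cast; ring⟩
  eventually_zero := h.eventually_zero

theorem eq_on_closure (h : IsStripPotential S θ g) (hθ : ContinuousOn θ (closure S)) :
    ∃ a : ℤ, ∀ x ∈ closure S, g x = θ x - a * Real.pi := by
  obtain ⟨a, ha⟩ := h.eq_on
  refine ⟨a, fun x hx ↦ ?_⟩
  have := EqOn.of_subset_closure (f := g) (g := fun x ↦ θ x - a * Real.pi) (s := S)
    (t := closure S) (fun x hx ↦ ha x hx) h.continuous.continuousOn
    (hθ.sub continuousOn_const) subset_closure subset_rfl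
  exact this hx

theorem hasCompactSupport (h : IsStripPotential S θ g) : HasCompactSupport g := by
  obtain ⟨R, hR⟩ := h.eventually_zero
  refine HasCompactSupport.intro (isCompact_closedBall (0 : Plane) R) fun x hx ↦ hR x ?_
  rw [mem_closedBall_zero_iff, not_le] at hx
  exact hx.le

/-- At small distances, values in `πℤ` must agree, and a segment that leaves `S` can be cut at a
frontier point. At large distances boundedness of `g` suffices. -/
theorem exists_lipschitzWith (h : IsStripPotential S θ g) (hS : IsOpen S) {K : NNReal}
    (hθ : LipschitzOnWith K θ (closure S)) : ∃ K', LipschitzWith K' g := by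
  obtain ⟨a, ha⟩ := h.eq_on_closure hθ.continuousOn
  have huc := h.hasCompactSupport.uniformContinuous_of_continuous h.continuous
  obtain ⟨M, hM⟩ := h.hasCompactSupport.exists_bound_of_continuous h.continuous
  obtain ⟨r, hr, hrg⟩ := Metric.uniformContinuous_iff.1 huc Real.pi Real.pi_pos
  have hM0 : 0 ≤ M := (norm_nonneg _).trans (hM 0)
  have heq : ∀ y ∉ S, ∀ z ∉ S, dist y z < r → g y = g z := by
    intro y hy z hz hd
    obtain ⟨n, hn⟩ := h.exists_int_of_notMem y hy
    obtain ⟨m, hm⟩ := h.exists_int_of_notMem z hz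
    have h1 := hrg hd
    rw [Real.dist_eq, hn, hm, ← sub_mul, abs_mul, abs_of_pos Real.pi_pos] at h1
    have h2 : |(n : ℝ) - m| < 1 := by
      by_contra hc
      nlinarith [Real.pi_pos]
    have h3 : |n - m| < 1 := by exact_mod_cast h2
    rw [hn, hm, sub_eq_zero.1 (Int.abs_lt_one_iff.1 h3)]
  have hcl : ∀ y ∈ closure S, ∀ z ∈ closure S, dist (g y) (g z) ≤ K * dist y z := by
    intro y hy z hz
    rw [ha y hy, ha z hz, dist_sub_right]
    exact hθ.dist_le_mul y hy z hz
  have hmix : ∀ y ∈ S, ∀ z ∉ S, dist y z < r → dist (g y) (g z) ≤ K * dist y z := by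
    intro y hy z hz hd
    obtain ⟨w, hw, hwf⟩ := IsPreconnected.inter_frontier_nonempty (s := S)
      (convex_segment y z).isPreconnected
      ⟨y, left_mem_segment ℝ y z, hy⟩ ⟨z, right_mem_segment ℝ y z, hz⟩
    have hwd := dist_add_dist_of_mem_segment hw
    have h1 : g w = g z := heq w (hS.frontier_eq ▸ hwf).2 z hz
      (by linarith [dist_nonneg (x := y) (y := w)])
    rw [← h1]
    refine (hcl y (subset_closure hy) w hwf.1).trans ?_
    gcongr
    linarith [dist_nonneg (x := w) (y := z)]
  have hloc : ∀ y z, dist y z < r → dist (g y) (g z) ≤ K * dist y z := by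
    intro y z hd
    by_cases hy : y ∈ S <;> by_cases hz : z ∈ S
    · exact hcl y (subset_closure hy) z (subset_closure hz)
    · exact hmix y hy z hz hd
    · rw [dist_comm y, dist_comm (g y)]
      exact hmix z hz y hy (by rwa [dist_comm])
    · rw [heq y hy z hz hd, dist_self]; positivity
  refine ⟨K + (2 * M / r).toNNReal, LipschitzWith.of_dist_le_mul fun y z ↦ ?_⟩
  rw [NNReal.coe_add, Real.coe_toNNReal _ (by positivity), add_mul]
  rcases lt_or_ge (dist y z) r with hd | hd
  · have : 0 ≤ 2 * M / r * dist y z := by positivity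
    linarith [hloc y z hd]
  · have h1 : dist (g y) (g z) ≤ 2 * M := by
      rw [dist_eq_norm]
      linarith [norm_sub_le (g y) (g z), hM y, hM z]
    have h2 : 2 * M ≤ 2 * M / r * dist y z := by
      rw [div_mul_eq_mul_div, le_div_iff₀ hr]; gcongr
    have : 0 ≤ (K : ℝ) * dist y z := by positivity
    linarith

theorem ne_int_mul_pi (h : IsStripPotential S θ g) (hθ : ∀ x ∈ S, Real.sin (θ x) ≠ 0) {x : Plane}
    (hx : x ∈ S) (n : ℤ) : g x ≠ n * Real.pi := by
  obtain ⟨a, ha⟩ := h.eq_on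
  intro hn
  refine hθ x hx (Real.sin_eq_zero_iff.2 ⟨n + a, ?_⟩)
  have := ha x hx
  push_cast; linarith

theorem mem_of_ne_int_mul_pi (h : IsStripPotential S θ g) {x : Plane}
    (hx : ∀ n : ℤ, g x ≠ n * Real.pi) : x ∈ S := by
  by_contra hxS
  obtain ⟨n, hn⟩ := h.exists_int_of_notMem x hxS
  exact hx n hn

theorem mem_of_pos_of_lt_pi (h : IsStripPotential S θ g) {x : Plane} (h0 : 0 < g x)
    (h1 : g x < Real.pi) : x ∈ S := by
  refine h.mem_of_ne_int_mul_pi fun n hn ↦ ?_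
  rw [hn] at h0 h1
  have h2 : (0 : ℝ) < n := pos_of_mul_pos_left h0 Real.pi_pos.le
  have h3 : (n : ℝ) < 1 := by nlinarith [Real.pi_pos]
  have h4 : 0 < n := by exact_mod_cast h2
  have h5 : n < 1 := by exact_mod_cast h3
  omega

/-- Otherwise `g`, being `0` far away, takes the value `π / 2` somewhere on the plane, necessarily
in `S`; connectedness of `S` then produces the forbidden value `π` inside `S`. -/
theorem lt_pi (h : IsStripPotential S θ g) (hS : IsPreconnected S)
    (hθ : ∀ x ∈ S, Real.sin (θ x) ≠ 0) {x : Plane} (hx : x ∈ S) : g x < Real.pi := by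
  by_contra hge
  rw [not_lt] at hge
  have hπ := Real.pi_pos
  obtain ⟨R, hR⟩ := h.eventually_zero
  have hz : g (EuclideanSpace.single 0 R) = 0 := hR _ (by simp [le_abs_self])
  obtain ⟨y, -, hy⟩ := (isPreconnected_univ (α := Plane)).intermediate_value (mem_univ _)
    (mem_univ x) h.continuous.continuousOn
    (show Real.pi / 2 ∈ Icc (g (EuclideanSpace.single 0 R)) (g x) by
      rw [hz]; constructor <;> linarith)
  have hyS : y ∈ S := h.mem_of_pos_of_lt_pi (by rw [hy]; positivity) (by rw [hy]; linarith)
  obtain ⟨w, hwS, hw⟩ := hS.intermediate_value hyS hx h.continuous.continuousOn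
    (show Real.pi ∈ Icc (g y) (g x) by rw [hy]; constructor <;> linarith)
  exact h.ne_int_mul_pi hθ hwS 1 (by simpa using hw)

theorem pos_or_neg (h : IsStripPotential S θ g) (hS : IsPreconnected S)
    (hθ : ∀ x ∈ S, Real.sin (θ x) ≠ 0) : (∀ x ∈ S, 0 < g x) ∨ ∀ x ∈ S, g x < 0 := by
  by_contra! hcon
  obtain ⟨⟨x, hx, hgx⟩, y, hy, hgy⟩ := hcon
  obtain ⟨w, hwS, hw⟩ := hS.intermediate_value hx hy h.continuous.continuousOn ⟨hgx, hgy⟩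
  exact h.ne_int_mul_pi hθ hwS 0 (by simpa using hw)

end IsStripPotential

/-! ### Regular points and foliation charts -/

/-- `p` is a regular point of `θ`, and the level set of `θ` through `p` has a tangent there. -/
def IsRegularPoint (θ : Plane → ℝ) (p : Plane) : Prop :=
  ∃ d τ : Plane, HasGradientAt θ d p ∧ d ≠ 0 ∧ τ ≠ 0 ∧ inner ℝ d τ = 0 ∧
    τ ∈ tangentConeAt ℝ {q | θ q = θ p} p

/-- Write `cos f - cos η` as a product of sines of the half sum and half difference. The first
factor is nonzero near `p`, so the second vanishes, and its argument is too small to be a nonzero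
multiple of `π`. -/
theorem eventually_eq_of_cos_eq {X : Type*} [TopologicalSpace X] {f η : X → ℝ} {p : X}
    (hf : ContinuousAt f p) (hη : ContinuousAt η p) (hp : η p = f p) (hsin : Real.sin (f p) ≠ 0)
    (hcos : ∀ᶠ q in 𝓝 p, Real.cos (η q) = Real.cos (f q)) : ∀ᶠ q in 𝓝 p, f q = η q := by
  have h1 : ContinuousAt (fun q ↦ Real.sin ((f q + η q) / 2)) p :=
    Real.continuous_sin.continuousAt.comp ((hf.add hη).div_const 2)
  have h2 : ContinuousAt (fun q ↦ |(f q - η q) / 2|) p := ((hf.sub hη).div_const 2).abs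
  have e1 : ∀ᶠ q in 𝓝 p, Real.sin ((f q + η q) / 2) ≠ 0 :=
    h1.eventually_ne (by simpa [hp] using hsin)
  have e2 : ∀ᶠ q in 𝓝 p, |(f q - η q) / 2| < Real.pi :=
    h2.eventually_lt_const (by simpa [hp] using Real.pi_pos)
  filter_upwards [hcos, e1, e2] with q hq hq1 hq2
  have h3 := Real.cos_sub_cos (f q) (η q)
  rw [hq, sub_self] at h3
  have h4 : Real.sin ((f q - η q) / 2) = 0 := by
    by_contra hne
    exact mul_ne_zero (mul_ne_zero (by norm_num) hq1) hne h3.symm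
  rw [abs_lt] at hq2
  have h5 := (Real.sin_eq_zero_iff_of_lt_of_lt hq2.1 hq2.2).1 h4
  linarith

/-- Away from `sin θ = 0` the sign and the multiple of `2π` relating `θ` to `x₂` are locally
constant. So `θ` is locally an affine function of a coordinate with nonzero differential, and
horizontal lines in the chart give the tangent. -/
theorem isRegularPoint_of_chart {θ : Plane → ℝ} {p : Plane} (hθ : ContinuousAt θ p)
    (hsin : Real.sin (θ p) ≠ 0) (e : OpenPartialHomeomorph Plane (ℝ × ℝ))
    (he : ContDiffOn ℝ ∞ e e.source) (he' : ContDiffOn ℝ ∞ e.symm e.target) (hp : p ∈ e.source)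
    (hcos : ∀ q ∈ e.source, Real.cos (e q).2 = Real.cos (θ q)) : IsRegularPoint θ p := by
  have hsrc : e.source ∈ 𝓝 p := e.open_source.mem_nhds hp
  have htgt : e.target ∈ 𝓝 (e p) := e.open_target.mem_nhds (e.map_source hp)
  have hD : HasFDerivAt e (fderiv ℝ e p) p :=
    ((he.contDiffAt hsrc).differentiableAt (by simp)).hasFDerivAt
  have hD' : HasFDerivAt e.symm (fderiv ℝ e.symm (e p)) (e p) :=
    ((he'.contDiffAt htgt).differentiableAt (by simp)).hasFDerivAt
  set D := fderiv ℝ e p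
  set D' := fderiv ℝ e.symm (e p)
  have hDD' : ∀ v, D (D' v) = v := fun v ↦ by
    have h1 : HasFDerivAt (e ∘ e.symm) (D.comp D') (e p) :=
      HasFDerivAt.comp (e p) (by rwa [e.left_inv hp]) hD'
    have h2 : HasFDerivAt (e ∘ e.symm) (ContinuousLinearMap.id ℝ (ℝ × ℝ)) (e p) := by
      refine (hasFDerivAt_id (e p)).congr_of_eventuallyEq ?_
      filter_upwards [htgt] with q hq
      exact e.right_inv hq
    exact congrArg (fun L : ℝ × ℝ →L[ℝ] ℝ × ℝ ↦ L v) (h1.unique h2)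
  obtain ⟨s, k, hs, hloc⟩ : ∃ s k : ℝ, s ≠ 0 ∧ ∀ᶠ q in 𝓝 p, θ q = k + s * (e q).2 := by
    have hec : ContinuousAt (fun q ↦ (e q).2) p := continuousAt_snd.comp (e.continuousAt hp)
    obtain ⟨k, hk | hk⟩ := Real.cos_eq_cos_iff.1 (hcos p hp)
    · refine ⟨1, 2 * k * Real.pi, one_ne_zero, eventually_eq_of_cos_eq hθ
        (continuousAt_const.add (continuousAt_const.mul hec)) (by rw [hk, one_mul]) hsin ?_⟩
      filter_upwards [hsrc] with q hq
      rw [← hcos q hq, one_mul, mul_right_comm, add_comm, mul_right_comm]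
      rw [show 2 * (k : ℝ) * Real.pi = k * (2 * Real.pi) by ring, Real.cos_add_int_mul_two_pi]
    · refine ⟨-1, 2 * k * Real.pi, by norm_num, eventually_eq_of_cos_eq hθ
        (continuousAt_const.add (continuousAt_const.mul hec)) (by rw [hk]; ring) hsin ?_⟩
      filter_upwards [hsrc] with q hq
      rw [← hcos q hq, show 2 * (k : ℝ) * Real.pi + -1 * (e q).2 = k * (2 * Real.pi) - (e q).2 by
        ring, Real.cos_int_mul_two_pi_sub]
  set L : Plane →L[ℝ] ℝ := s • (ContinuousLinearMap.snd ℝ ℝ ℝ).comp D with hL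
  have hθL : HasFDerivAt θ L p := by
    have h1 : HasFDerivAt (fun q ↦ k + s * (e q).2) L p := by
      have := ((hD.snd).const_mul s).const_add k
      exact this
    exact h1.congr_of_eventuallyEq hloc
  set d : Plane := (InnerProductSpace.toDual ℝ Plane).symm L with hd
  have hdL : ∀ v, inner ℝ d v = L v := fun v ↦ by
    rw [hd, InnerProductSpace.toDual_symm_apply]
  refine ⟨d, D' (1, 0), ?_, ?_, ?_, ?_, ?_⟩
  · rw [hasGradientAt_iff_hasFDerivAt, hd, LinearIsometryEquiv.apply_symm_apply]
    exact hθL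
  · intro h0
    have := hdL (D' (0, 1))
    rw [h0, inner_zero_left] at this
    simp [hL, hDD'] at this
    exact hs this.symm
  · intro h0
    have := hDD' (1, 0)
    rw [h0, map_zero] at this
    exact zero_ne_one (congrArg Prod.fst this)
  · rw [hdL]; simp [hL, hDD']
  · have hline : HasDerivAt (fun t : ℝ ↦ e p + t • ((1, 0) : ℝ × ℝ)) (1, 0) 0 := by
      simpa using ((hasDerivAt_id (0 : ℝ)).smul_const ((1, 0) : ℝ × ℝ)).const_add (e p)
    have hcurve : HasDerivAt (fun t : ℝ ↦ e.symm (e p + t • ((1, 0) : ℝ × ℝ))) (D' (1, 0)) 0 := by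
      have h1 : HasFDerivAt e.symm D' (e p + (0 : ℝ) • ((1, 0) : ℝ × ℝ)) := by simpa using hD'
      exact h1.comp_hasDerivAt 0 hline
    have hc0 : e.symm (e p + (0 : ℝ) • ((1, 0) : ℝ × ℝ)) = p := by simp [e.left_inv hp]
    have htend : Tendsto (fun t : ℝ ↦ e.symm (e p + t • ((1, 0) : ℝ × ℝ))) (𝓝[≠] 0) (𝓝 p) := by
      have := hcurve.continuousAt.tendsto
      rw [hc0] at this
      exact this.mono_left nhdsWithin_le_nhds
    have hlt : Tendsto (fun t : ℝ ↦ e p + t • ((1, 0) : ℝ × ℝ)) (𝓝[≠] 0) (𝓝 (e p)) := by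
      have := hline.continuousAt.tendsto
      simp only [zero_smul, add_zero] at this
      exact this.mono_left nhdsWithin_le_nhds
    refine mem_tangentConeAt_of_seq (𝓝[≠] (0 : ℝ)) (fun t ↦ t⁻¹)
      (fun t ↦ e.symm (e p + t • ((1, 0) : ℝ × ℝ)) - p) ?_ ?_ ?_
    · simpa using htend.sub_const p
    · filter_upwards [htend.eventually hloc, hlt.eventually htgt] with t ht ht'
      simp only [add_sub_cancel]
      rw [ht, hloc.self_of_nhds, e.right_inv ht']
      simp
    · have := hasDerivAt_iff_tendsto_slope_zero.1 hcurve
      simpa [hc0, e.left_inv hp] using this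

namespace IsRegularPoint

variable {θ : Plane → ℝ} {p : Plane}

theorem neg (h : IsRegularPoint θ p) : IsRegularPoint (fun x ↦ -θ x) p := by
  obtain ⟨d, τ, hd, hd0, hτ0, hdτ, hτ⟩ := h
  refine ⟨-d, τ, ?_, neg_ne_zero.2 hd0, hτ0, by simp [hdτ], by simpa using hτ⟩
  rw [hasGradientAt_iff_hasFDerivAt, map_neg]
  exact hd.hasFDerivAt.neg

theorem not_isLocalMin (h : IsRegularPoint θ p) : ¬ IsLocalMin θ p := by
  obtain ⟨d, τ, hd, hd0, -⟩ := h
  intro hm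
  have := hm.hasFDerivAt_eq_zero hd.hasFDerivAt
  exact hd0 ((map_eq_zero_iff _ (InnerProductSpace.toDual ℝ Plane).injective).1 this)

end IsRegularPoint

/-- The plane has no three pairwise orthogonal nonzero vectors. This excludes an inner normal
orthogonal to the gradient. -/
theorem eq_zero_or_eq_zero_of_orthogonal {n d τ : Plane} (hnd : inner ℝ n d = 0)
    (hnτ : inner ℝ n τ = 0) (hdτ : inner ℝ d τ = 0) (hn : n ≠ 0) : d = 0 ∨ τ = 0 := by
  simp only [PiLp.inner_apply, Fin.sum_univ_two, RCLike.inner_apply, conj_trivial] at hnd hnτ hdτ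
  have key : (‖d‖ ^ 2 * ‖τ‖ ^ 2) * (‖n‖ ^ 2) ^ 2 = 0 := by
    simp only [EuclideanSpace.norm_sq_eq, Fin.sum_univ_two, Real.norm_eq_abs, sq_abs]
    have h1 : (d 0 ^ 2 + d 1 ^ 2) * (n 0 ^ 2 + n 1 ^ 2) = (n 0 * d 1 - n 1 * d 0) ^ 2 := by
      linear_combination (d 0 * n 0 + d 1 * n 1) * hnd
    have h2 : (τ 0 ^ 2 + τ 1 ^ 2) * (n 0 ^ 2 + n 1 ^ 2) = (n 0 * τ 1 - n 1 * τ 0) ^ 2 := by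
      linear_combination (τ 0 * n 0 + τ 1 * n 1) * hnτ
    have h3 : (n 0 * d 1 - n 1 * d 0) * (n 0 * τ 1 - n 1 * τ 0) = 0 := by
      linear_combination (n 0 ^ 2 + n 1 ^ 2) * hdτ - (n 0 * τ 0 + n 1 * τ 1) * hnd
    linear_combination (τ 0 ^ 2 + τ 1 ^ 2) * (n 0 ^ 2 + n 1 ^ 2) * h1 +
      (n 0 * d 1 - n 1 * d 0) ^ 2 * h2 +
      (n 0 * d 1 - n 1 * d 0) * (n 0 * τ 1 - n 1 * τ 0) * h3
  have hn' : (‖n‖ ^ 2) ^ 2 ≠ 0 := by positivity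
  simpa [hn'] using key

theorem eventually_lt_of_inner_gradient_pos {θ : Plane → ℝ} {p d n : Plane}
    (hd : HasGradientAt θ d p) (hn : 0 < inner ℝ n d) :
    ∀ᶠ s : ℝ in 𝓝[>] 0, θ p < θ (p + s • n) := by
  have hline : HasDerivAt (fun t : ℝ ↦ p + t • n) n 0 := by
    simpa using ((hasDerivAt_id (0 : ℝ)).smul_const n).const_add p
  have h1 : HasDerivAt (fun t : ℝ ↦ θ (p + t • n)) (inner ℝ d n) 0 := by
    have h2 : HasFDerivAt θ (InnerProductSpace.toDual ℝ Plane d) (p + (0 : ℝ) • n) := by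
      simpa using hd.hasFDerivAt
    have h3 := h2.comp_hasDerivAt (0 : ℝ) hline
    rw [InnerProductSpace.toDual_apply_apply] at h3
    exact h3
  have h3 := hasDerivAt_iff_tendsto_slope_zero.1 h1
  have h4 := h3.eventually_const_lt (by rwa [real_inner_comm])
  have h5 : ∀ᶠ s : ℝ in 𝓝[>] 0, 0 < s⁻¹ • (θ (p + (0 + s) • n) - θ (p + (0 : ℝ) • n)) :=
    h4.filter_mono (nhdsWithin_mono _ fun x hx ↦ ne_of_gt hx)
  filter_upwards [h5, self_mem_nhdsWithin] with s hs hs0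
  have hs0' : (0 : ℝ) < s⁻¹ := inv_pos.2 hs0
  rw [zero_add, zero_smul, add_zero, smul_eq_mul] at hs
  exact sub_pos.1 (pos_of_mul_pos_right hs hs0'.le)

theorem HasGradientAt.fun_neg {θ : Plane → ℝ} {p d : Plane} (hd : HasGradientAt θ d p) :
    HasGradientAt (fun x ↦ -θ x) (-d) p := by
  rw [hasGradientAt_iff_hasFDerivAt, map_neg]
  exact hd.hasFDerivAt.neg

/-! ### Local criterion for the orientation -/

/-- If the points near `p` at which `θ` is larger than at `p` are inside the level curve, and those
at which it is smaller are not, then the induced orientation at `p` is `1`. -/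
theorem inducedOrientation_eq_one {Ω : Set Plane} {θ : Plane → ℝ} {p : Plane}
    (hreg : IsRegularPoint θ p) (hcurve : ∀ᶠ q in 𝓝 p, θ q = θ p → q ∈ levelCurve Ω θ p)
    (hin : ∀ᶠ q in 𝓝 p, θ p < θ q → q ∈ insideOf (levelCurve Ω θ p))
    (hout : ∀ᶠ q in 𝓝 p, θ q < θ p → q ∉ insideOf (levelCurve Ω θ p)) :
    inducedOrientation Ω θ p = 1 := by
  obtain ⟨d, τ, hd, hd0, hτ0, hdτ, hτ⟩ := hreg
  set γ := levelCurve Ω θ p with hγ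
  have hγθ : ∀ q ∈ γ, θ q = θ p := fun q hq ↦ (connectedComponentIn_subset _ _ hq).2
  have hτγ : τ ∈ tangentConeAt ℝ γ p := by
    rw [← tangentConeAt_inter_nhds hcurve] at hτ
    exact tangentConeAt_mono (fun q hq ↦ hq.2 hq.1) hτ
  have htend : ∀ n : Plane, Tendsto (fun s : ℝ ↦ p + s • n) (𝓝[>] 0) (𝓝 p) := fun n ↦ by
    have : Continuous fun s : ℝ ↦ p + s • n := by fun_prop
    have h := this.tendsto 0
    rw [zero_smul, add_zero] at h
    exact h.mono_left nhdsWithin_le_nhds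
  have hex : ∃ n, IsInnerNormal γ p n := by
    have hnd : 0 < ‖d‖ := norm_pos_iff.2 hd0
    refine ⟨‖d‖⁻¹ • d, by rw [norm_smul, norm_inv, norm_norm, inv_mul_cancel₀ hnd.ne'],
      fun v hv ↦ ?_, ?_⟩
    · have h1 : HasFDerivWithinAt θ (InnerProductSpace.toDual ℝ Plane d) γ p :=
        hd.hasFDerivAt.hasFDerivWithinAt
      have h2 : HasFDerivWithinAt θ (0 : Plane →L[ℝ] ℝ) γ p :=
        (hasFDerivWithinAt_const (θ p) p γ).congr hγθ rfl
      have h3 := h1.unique_on h2 hv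
      rw [inner_smul_left]
      simp at h3
      simp [h3]
    · have h1 := eventually_lt_of_inner_gradient_pos (n := ‖d‖⁻¹ • d) hd (by
        rw [inner_smul_left, real_inner_self_eq_norm_sq]; simp; positivity)
      filter_upwards [h1, (htend _).eventually hin] with s hs hs'
      exact hs' hs
  -- The chosen normal need not be the normalised gradient a priori, so the sign is computed for an
  -- arbitrary inner normal.
  have hn : IsInnerNormal γ p (innerNormal γ p) := by
    rw [innerNormal, dif_pos hex]; exact hex.choose_spec
  rw [inducedOrientation, ← hγ, hd.gradient]
  set n := innerNormal γ p
  have hn0 : n ≠ 0 := by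
    intro h
    have := hn.1
    rw [h, norm_zero] at this
    exact zero_ne_one this
  have hpos : 0 < inner ℝ n d := by
    rcases lt_trichotomy (inner ℝ n d) 0 with hlt | heq | hgt
    · exfalso
      have h1 := eventually_lt_of_inner_gradient_pos (n := n) hd.fun_neg (by
        rw [inner_neg_right]; linarith)
      obtain ⟨s, hs1, hs2, hs3⟩ := (h1.and (hn.2.2.and ((htend n).eventually hout))).exists
      exact hs3 (neg_lt_neg_iff.1 hs1) hs2
    · rcases eq_zero_or_eq_zero_of_orthogonal heq (hn.2.1 τ hτγ) hdτ hn0 with h | h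
      · exact absurd h hd0
      · exact absurd h hτ0
    · exact hgt
  rw [sign_pos hpos]; rfl

theorem levelCurve_neg (Ω : Set Plane) (θ : Plane → ℝ) (p : Plane) :
    levelCurve Ω (fun x ↦ -θ x) p = levelCurve Ω θ p := by
  simp [levelCurve]

theorem inducedOrientation_neg (Ω : Set Plane) (θ : Plane → ℝ) (p : Plane) :
    inducedOrientation Ω (fun x ↦ -θ x) p = -inducedOrientation Ω θ p := by
  have h : gradient (fun x ↦ -θ x) p = -gradient θ p := by
    rw [gradient, gradient, fderiv_fun_neg, map_neg]
  rw [inducedOrientation, inducedOrientation, levelCurve_neg, h, inner_neg_right, Left.sign_neg]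
  simp

/-! ### Sublevel sets in an annulus and insides of level sets -/

theorem mem_connectedComponentIn_of_mem_closure {X : Type*} [TopologicalSpace X] {F : Set X}
    {q x : X} (hx : x ∈ closure (connectedComponentIn F q)) (hxF : x ∈ F) :
    x ∈ connectedComponentIn F q := by
  by_cases hq : q ∈ F
  · have h : IsPreconnected (insert x (connectedComponentIn F q)) :=
      isPreconnected_connectedComponentIn.subset_closure (subset_insert _ _)
        (insert_subset hx subset_closure)
    exact h.subset_connectedComponentIn (mem_insert_of_mem _ (mem_connectedComponentIn hq))
      (insert_subset hxF (connectedComponentIn_subset _ _)) (mem_insert _ _)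
  · rw [connectedComponentIn_eq_empty hq, closure_empty] at hx
    exact absurd hx (notMem_empty x)

theorem IsPreconnected.lt_of_forall_ne {X : Type*} [TopologicalSpace X] {s : Set X}
    (hs : IsPreconnected s) {f : X → ℝ} (hf : ContinuousOn f s) {c : ℝ} (hne : ∀ x ∈ s, f x ≠ c)
    {x y : X} (hx : x ∈ s) (hy : y ∈ s) (hxc : f x < c) : f y < c := by
  by_contra h
  obtain ⟨z, hz, hfz⟩ := hs.intermediate_value hx hy hf ⟨hxc.le, not_lt.1 h⟩
  exact hne z hz hfz

/-- A sublevel set of a positive function without local minima on the image of an open annulus is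
preconnected if the function is small at exactly one of the two ends of the annulus. -/
theorem isPreconnected_sublevel_of_annulus {S : Set Plane} (hS : IsOpen S)
    (hSb : Bornology.IsBounded S) {ψ : Circle × ℝ → Plane}
    (hψ : ContinuousOn ψ (univ ×ˢ Icc (-1) 1)) (hψS : ψ '' (univ ×ˢ Ioo (-1) 1) = S)
    {f : Plane → ℝ} (hf : Continuous f) {c : ℝ} (hc : 0 < c) (hpos : ∀ x ∈ S, 0 < f x)
    (hcl : ∀ x ∈ closure S, 0 < f x → f x < c → x ∈ S) (hmin : ∀ x ∈ S, ¬ IsLocalMin f x)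
    (h1 : ∀ z, f (ψ (z, 1)) = 0) (h2 : ∀ z, 0 < f (ψ (z, -1))) :
    IsPreconnected {x | x ∈ S ∧ f x < c} := by
  have hF : ContinuousOn (fun x ↦ f (ψ x)) (univ ×ˢ Icc (-1 : ℝ) 1) := hf.comp_continuousOn hψ
  have hK : IsCompact ((univ : Set Circle) ×ˢ Icc (-1 : ℝ) 1) := isCompact_univ.prod isCompact_Icc
  obtain ⟨η, hη0, hη1, hη⟩ : ∃ η : ℝ, 0 < η ∧ η < 1 ∧
      ∀ z : Circle, ∀ t ∈ Ioo (1 - η) 1, f (ψ (z, t)) < c := by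
    have hT : IsCompact (Prod.snd '' ((univ ×ˢ Icc (-1 : ℝ) 1) ∩ (fun x ↦ f (ψ x)) ⁻¹' Ici c)) := by
      refine IsCompact.image ?_ continuous_snd
      exact hK.of_isClosed_subset (hF.preimage_isClosed_of_isClosed hK.isClosed isClosed_Ici)
        inter_subset_left
    have h1T : (1 : ℝ) ∈ (Prod.snd '' ((univ ×ˢ Icc (-1 : ℝ) 1) ∩
        (fun x : Circle × ℝ ↦ f (ψ x)) ⁻¹' Ici c))ᶜ := by
      rintro ⟨⟨z, t⟩, ⟨-, hzt⟩, rfl : t = 1⟩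
      have : c ≤ f (ψ (z, 1)) := hzt
      rw [h1] at this
      linarith
    obtain ⟨η, hη, hball⟩ := Metric.isOpen_iff.1 hT.isClosed.isOpen_compl _ h1T
    refine ⟨min η (1 / 2), by positivity, (min_le_right _ _).trans_lt (by norm_num),
      fun z t ht ↦ ?_⟩
    by_contra hge
    have ht1 : 1 - η < t := by linarith [ht.1, min_le_left η (1 / 2)]
    have ht2 : -1 ≤ t := by linarith [ht.1, min_le_right η (1 / 2)]
    refine hball (show t ∈ Metric.ball 1 η from ?_)
      ⟨(z, t), ⟨⟨mem_univ _, ht2, ht.2.le⟩, not_lt.1 hge⟩, rfl⟩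
    rw [Metric.mem_ball, Real.dist_eq, abs_lt]
    constructor <;> linarith [ht.2]
  -- A connected collar at the end where `f` vanishes. It lies in the sublevel set, and every
  -- component of that set will be shown to contain it.
  set C : Set Plane := ψ '' (univ ×ˢ Ioo (1 - η) 1) with hC
  have hCS : C ⊆ {x | x ∈ S ∧ f x < c} := by
    rintro _ ⟨⟨z, t⟩, ⟨-, ht⟩, rfl⟩
    refine ⟨hψS ▸ mem_image_of_mem ψ ⟨mem_univ _, ?_, ht.2⟩, hη z t ht⟩
    have := ht.1
    simp only at this ⊢
    linarith
  have hCc : IsPreconnected C := by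
    refine (isPreconnected_univ.prod isPreconnected_Ioo).image ψ (hψ.mono ?_)
    exact prod_mono subset_rfl (Ioo_subset_Icc_self.trans (Icc_subset_Icc_left (by linarith)))
  obtain ⟨δ, hδ0, hδ⟩ : ∃ δ : ℝ, 0 < δ ∧ ∀ z : Circle, ∀ t ∈ Icc (-1) (1 - η), δ ≤ f (ψ (z, t)) := by
    have hsub : (univ : Set Circle) ×ˢ Icc (-1 : ℝ) (1 - η) ⊆ univ ×ˢ Icc (-1) 1 :=
      prod_mono subset_rfl (Icc_subset_Icc_right (by linarith))
    obtain ⟨δ, hδ0, hδ⟩ := (isCompact_univ.prod isCompact_Icc).exists_forall_le' (a := 0)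
      (hF.mono hsub) (fun x hx ↦ by
        obtain ⟨z, t⟩ := x
        obtain ⟨-, ht1, ht2⟩ := hx
        simp only at ht1 ht2 ⊢
        rcases ht1.eq_or_lt with rfl | ht1
        · exact h2 z
        · exact hpos _ (hψS ▸ mem_image_of_mem ψ ⟨mem_univ _, ht1, by simp only; linarith⟩))
    exact ⟨δ, hδ0, fun z t ht ↦ hδ (z, t) ⟨mem_univ _, ht⟩⟩
  have hV : IsOpen {x | x ∈ S ∧ f x < c} := hS.inter (isOpen_lt hf continuous_const)
  obtain ⟨y₀, hy₀⟩ : C.Nonempty :=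
    ⟨ψ (1, 1 - η / 2), (1, 1 - η / 2), ⟨mem_univ _, by simp only; constructor <;> linarith⟩, rfl⟩
  refine isPreconnected_of_forall y₀ fun q hq ↦ ⟨connectedComponentIn {x | x ∈ S ∧ f x < c} q,
    connectedComponentIn_subset _ _, ?_, mem_connectedComponentIn hq,
    isPreconnected_connectedComponentIn⟩
  set V := connectedComponentIn {x | x ∈ S ∧ f x < c} q with hVdef
  have hqV : q ∈ V := mem_connectedComponentIn hq
  have hVS : V ⊆ S := fun x hx ↦ (connectedComponentIn_subset _ _ hx).1
  have hVc : IsCompact (closure V) := (hSb.subset hVS).isCompact_closure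
  -- A positive minimum over `closure V` would be a local minimum in `S`. So `f` falls below `δ` on
  -- `V`, which is possible only in the collar.
  obtain ⟨x, hxV, hx⟩ := hVc.exists_isMinOn ⟨q, subset_closure hqV⟩ hf.continuousOn
  have hfx : f x ≤ 0 := by
    by_contra hlt
    rw [not_le] at hlt
    have hxc : f x < c := (hx (subset_closure hqV)).trans_lt hq.2
    have hxS : x ∈ S := hcl x (closure_mono hVS hxV) hlt hxc
    have hxV' : x ∈ V := mem_connectedComponentIn_of_mem_closure hxV ⟨hxS, hxc⟩
    refine hmin x hxS ?_
    filter_upwards [hV.connectedComponentIn.mem_nhds hxV'] with y hy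
    exact hx (subset_closure hy)
  obtain ⟨y, hyδ, hyV⟩ := mem_closure_iff.1 hxV {y | f y < δ} (isOpen_lt hf continuous_const)
    (hfx.trans_lt hδ0)
  have hyC : y ∈ C := by
    have hyS := hVS hyV
    rw [← hψS] at hyS
    obtain ⟨⟨z, t⟩, ⟨-, ht1, ht2⟩, rfl⟩ := hyS
    refine ⟨(z, t), ⟨mem_univ _, ?_, ht2⟩, rfl⟩
    by_contra hle
    exact absurd hyδ (not_lt.2 (hδ z t ⟨le_of_lt ht1, not_lt.1 hle⟩))
  have hsub := hCc.subset_connectedComponentIn hyC hCS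
  rw [← connectedComponentIn_eq hyV] at hsub
  exact hsub hy₀

/-- On the component of `q` off the level set `g` stays above `c > 0`, so this component cannot
reach the region where `g = 0`. -/
theorem mem_insideOf_level_of_lt {g : Plane → ℝ} (hg : Continuous g) {R : ℝ}
    (hfar : ∀ x, R ≤ ‖x‖ → g x = 0) {c : ℝ} (hc : 0 < c) {q : Plane} (hq : c < g q) :
    q ∈ insideOf {x | g x = c} := by
  have hqc : q ∈ {x | g x = c}ᶜ := fun h : g q = c ↦ hq.ne' h
  refine ⟨hqc, (Metric.isBounded_ball (x := (0 : Plane)) (r := R)).subset fun y hy ↦ ?_⟩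
  rw [mem_ball_zero_iff]
  by_contra hge
  have h0 := hfar y (not_lt.1 hge)
  have := isPreconnected_connectedComponentIn.lt_of_forall_ne hg.continuousOn
    (fun x hx ↦ connectedComponentIn_subset _ _ hx) hy (mem_connectedComponentIn hqc)
    (by rw [h0]; exact hc)
  linarith

/-- A frontier point of the unbounded component lies on the level set, hence in `S`. So that
component meets the connected set of points of `S` below `c`, and therefore contains all of it. -/
theorem notMem_insideOf_level_of_lt {g : Plane → ℝ} (hg : Continuous g) {R : ℝ}
    (hfar : ∀ x, R ≤ ‖x‖ → g x = 0) {c : ℝ} (hc : 0 < c) {p : Plane} (hp : g p = c)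
    {S : Set Plane} (hS : IsOpen S) (hLS : {x | g x = c} ⊆ S)
    (hA : IsPreconnected {x | x ∈ S ∧ g x < c}) {q : Plane} (hqS : q ∈ S) (hq : g q < c) :
    q ∉ insideOf {x | g x = c} := by
  rintro ⟨hqc, hbdd⟩
  set F : Set Plane := {x | g x = c}ᶜ with hF
  have hFo : IsOpen F := (isClosed_eq hg continuous_const).isOpen_compl
  set E : Set Plane := {x | max R 1 ≤ ‖x‖} with hE
  have hEF : E ⊆ F := fun x hx hxc ↦ by
    have h1 : g x = c := hxc
    rw [hfar x ((le_max_left R 1).trans hx)] at h1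
    exact hc.ne h1
  have hE' : ∀ r : ℝ, max R 1 ≤ r → EuclideanSpace.single 0 r ∈ E := fun r hr ↦ by
    simp only [hE, mem_ofPred_eq, PiLp.norm_single, Real.norm_eq_abs]
    exact hr.trans (le_abs_self r)
  set z : Plane := EuclideanSpace.single 0 (max R 1)
  have hzE : z ∈ E := hE' _ le_rfl
  have hz : z ∈ F := hEF hzE
  set V := connectedComponentIn F z with hV
  have hzV : z ∈ V := mem_connectedComponentIn hz
  have hEV : E ⊆ V := (isPreconnected_setOf_le_norm (by positivity)).subset_connectedComponentIn
    hzE hEF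
  have hVo : IsOpen V := hFo.connectedComponentIn
  have hpV : p ∉ V := fun h ↦ connectedComponentIn_subset _ _ h hp
  obtain ⟨w, -, hw⟩ := (isPreconnected_univ (α := Plane)).inter_frontier_nonempty (s := V)
    ⟨z, mem_univ _, hzV⟩ ⟨p, mem_univ _, hpV⟩
  have hwc : g w = c := by
    by_contra hne
    exact (hVo.frontier_eq ▸ hw).2 (mem_connectedComponentIn_of_mem_closure hw.1 hne)
  obtain ⟨y, hyS, hyV⟩ := mem_closure_iff.1 hw.1 S hS (hLS hwc)
  have hyc : g y < c := isPreconnected_connectedComponentIn.lt_of_forall_ne hg.continuousOn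
    (fun x hx ↦ connectedComponentIn_subset _ _ hx) hzV hyV
    (by rw [hfar z ((le_max_left R 1).trans hzE)]; exact hc)
  have hAF : {x | x ∈ S ∧ g x < c} ⊆ F := fun x hx h ↦ hx.2.ne h
  have hqV : q ∈ V := by
    rw [hV, connectedComponentIn_eq hyV]
    exact hA.subset_connectedComponentIn ⟨hyS, hyc⟩ hAF ⟨hqS, hq⟩
  rw [← connectedComponentIn_eq hqV] at hbdd
  obtain ⟨r, hr⟩ := hbdd.subset_ball 0
  have := hr (hEV (hE' (max r (max R 1)) (le_max_right _ _)))
  rw [mem_ball_zero_iff, PiLp.norm_single, Real.norm_eq_abs] at this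
  linarith [le_abs_self (max r (max R 1)), le_max_left r (max R 1)]

theorem level_subset_closure_sublevel {g : Plane → ℝ} {S : Set Plane} {c : ℝ} (hS : IsOpen S)
    (hLS : {x | g x = c} ⊆ S) (hmin : ∀ x ∈ S, ¬ IsLocalMin g x) :
    {x | g x = c} ⊆ closure {x | x ∈ S ∧ g x < c} := by
  intro p hp
  have hpS := hLS hp
  have h := hmin p hpS
  rw [IsLocalMin, IsMinFilter, not_eventually] at h
  rw [mem_closure_iff_frequently]
  refine (h.and_eventually (hS.mem_nhds hpS)).mono fun x hx ↦ ⟨hx.2, ?_⟩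
  have hp' : g p = c := hp
  rw [← hp']
  exact not_le.1 hx.1

/-! ### Orientation of a strip -/

/-- The properties of a strip of a phase function that determine its orientation. -/
structure IsStrip (Ω S : Set Plane) (θ : Plane → ℝ) : Prop where
  isOpen : IsOpen S
  isPreconnected : IsPreconnected S
  isBounded : Bornology.IsBounded S
  nonempty : S.Nonempty
  subset : S ⊆ Ω
  sin_ne : ∀ x ∈ S, Real.sin (θ x) ≠ 0
  subset_of_isPreconnected : ∀ T : Set Plane, IsPreconnected T →
    (∀ x ∈ T, x ∈ Ω ∧ Real.sin (θ x) ≠ 0) → (T ∩ S).Nonempty → T ⊆ S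
  continuousOn : ContinuousOn θ (closure S)
  sin_eq : ∀ x ∈ frontier S, Real.sin (θ x) = 0
  isRegularPoint : ∀ x ∈ S, IsRegularPoint θ x
  exists_annulus : ∃ ψ : Circle × ℝ → Plane, ContinuousOn ψ (univ ×ˢ Icc (-1) 1) ∧
    ψ '' (univ ×ˢ Ioo (-1) 1) = S ∧ (∀ z, Real.cos (θ (ψ (z, 1))) = 1) ∧
    ∀ z, Real.cos (θ (ψ (z, -1))) = -1

theorem continuousOn_annulus_flip {ψ : Circle × ℝ → Plane}
    (hψ : ContinuousOn ψ (univ ×ˢ Icc (-1) 1)) :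
    ContinuousOn (fun x : Circle × ℝ ↦ ψ (x.1, -x.2)) (univ ×ˢ Icc (-1) 1) := by
  refine hψ.comp (by fun_prop) fun x hx ↦ ⟨mem_univ _, ?_⟩
  have := hx.2
  simp only [mem_Icc] at this ⊢
  constructor <;> linarith

theorem image_annulus_flip (ψ : Circle × ℝ → Plane) :
    (fun x : Circle × ℝ ↦ ψ (x.1, -x.2)) '' (univ ×ˢ Ioo (-1) 1) = ψ '' (univ ×ˢ Ioo (-1) 1) := by
  ext y
  constructor <;>
  · rintro ⟨⟨z, t⟩, ⟨-, ht1, ht2⟩, rfl⟩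
    exact ⟨(z, -t), ⟨mem_univ _, by simp only at *; linarith, by simp only at *; linarith⟩,
      by simp⟩

namespace IsStrip

variable {Ω S : Set Plane} {θ g : Plane → ℝ}

theorem neg (h : IsStrip Ω S θ) : IsStrip Ω S (fun x ↦ -θ x) where
  isOpen := h.isOpen
  isPreconnected := h.isPreconnected
  isBounded := h.isBounded
  nonempty := h.nonempty
  subset := h.subset
  sin_ne := by simpa using h.sin_ne
  subset_of_isPreconnected := by simpa using h.subset_of_isPreconnected
  continuousOn := h.continuousOn.neg
  sin_eq := by simpa using h.sin_eq
  isRegularPoint x hx := (h.isRegularPoint x hx).neg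
  exists_annulus := by simpa using h.exists_annulus

theorem exists_annulus_of_pos (h : IsStrip Ω S θ) (hg : IsStripPotential S θ g)
    (hpos : ∀ x ∈ S, 0 < g x) : ∃ ψ : Circle × ℝ → Plane,
      ContinuousOn ψ (univ ×ˢ Icc (-1) 1) ∧ ψ '' (univ ×ˢ Ioo (-1) 1) = S ∧
      (∀ z, g (ψ (z, 1)) = 0) ∧ ∀ z, g (ψ (z, -1)) = Real.pi := by
  obtain ⟨ψ, hψ, hψS, h1, h2⟩ := h.exists_annulus
  obtain ⟨a, ha⟩ := hg.eq_on_closure h.continuousOn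
  have hψcl : ∀ z, ∀ t ∈ Icc (-1 : ℝ) 1, ψ (z, t) ∈ closure S := fun z t ht ↦ by
    have hmaps : MapsTo ψ (univ ×ˢ Ioo (-1) 1) S := fun x hx ↦ hψS ▸ mem_image_of_mem ψ hx
    have hcl : closure ((univ : Set Circle) ×ˢ Ioo (-1 : ℝ) 1) = univ ×ˢ Icc (-1) 1 := by
      rw [closure_prod_eq, closure_univ, closure_Ioo (by norm_num)]
    have := hmaps.closure_of_continuousOn (by rwa [hcl])
    rw [hcl] at this
    exact this ⟨mem_univ _, ht⟩
  have hrange : ∀ x ∈ closure S, g x ∈ Icc 0 Real.pi := fun x hx ↦ by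
    refine closure_minimal (t := g ⁻¹' Icc 0 Real.pi) (fun y hy ↦ ?_)
      (isClosed_Icc.preimage hg.continuous) hx
    exact ⟨(hpos y hy).le, (hg.lt_pi h.isPreconnected h.sin_ne hy).le⟩
  have hzero : ∀ x ∈ closure S, Real.cos (g x) = 1 → g x = 0 := fun x hx hcos ↦
    Real.injOn_cos (hrange x hx) ⟨le_rfl, Real.pi_pos.le⟩ (by rw [hcos, Real.cos_zero])
  have hpi : ∀ x ∈ closure S, Real.cos (g x) = -1 → g x = Real.pi := fun x hx hcos ↦
    Real.injOn_cos (hrange x hx) ⟨Real.pi_pos.le, le_rfl⟩ (by rw [hcos, Real.cos_pi])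
  have m1 : (1 : ℝ) ∈ Icc (-1 : ℝ) 1 := by simp
  have m2 : (-1 : ℝ) ∈ Icc (-1 : ℝ) 1 := by simp
  have hcos : ∀ x ∈ closure S, Real.cos (g x) = (-1) ^ a * Real.cos (θ x) := fun x hx ↦ by
    rw [ha x hx, Real.cos_sub_int_mul_pi]
  -- For odd `a` the shift by `aπ` exchanges `cos = 1` and `cos = -1`, so the annulus is turned
  -- around.
  rcases Int.even_or_odd a with hev | hodd
  · refine ⟨ψ, hψ, hψS, fun z ↦ hzero _ (hψcl z 1 m1) ?_, fun z ↦ hpi _ (hψcl z _ m2) ?_⟩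
    · rw [hcos _ (hψcl z 1 m1), h1, hev.neg_one_zpow, one_mul]
    · rw [hcos _ (hψcl z _ m2), h2, hev.neg_one_zpow, one_mul]
  · refine ⟨fun x ↦ ψ (x.1, -x.2), continuousOn_annulus_flip hψ, by rw [image_annulus_flip, hψS],
      fun z ↦ hzero _ (hψcl z _ m2) ?_, fun z ↦ ?_⟩
    · rw [hcos _ (hψcl z _ m2), h2, hodd.neg_one_zpow]; norm_num
    · simp only [neg_neg]
      refine hpi _ (hψcl z 1 m1) ?_
      rw [hcos _ (hψcl z 1 m1), h1, hodd.neg_one_zpow]; norm_num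

theorem not_isLocalMin (h : IsStrip Ω S θ) (hg : IsStripPotential S θ g) {x : Plane}
    (hx : x ∈ S) : ¬ IsLocalMin g x := by
  obtain ⟨a, ha⟩ := hg.eq_on
  intro hm
  refine (h.isRegularPoint x hx).not_isLocalMin ?_
  filter_upwards [hm, h.isOpen.mem_nhds hx] with y hy hyS
  rw [ha x hx, ha y hyS] at hy
  linarith

theorem inducedOrientation_eq_one (h : IsStrip Ω S θ) (hg : IsStripPotential S θ g)
    (hpos : ∀ x ∈ S, 0 < g x) {p : Plane} (hp : p ∈ S) : inducedOrientation Ω θ p = 1 := by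
  have hπ := Real.pi_pos
  have hgc := hg.continuous
  obtain ⟨R, hR⟩ := hg.eventually_zero
  obtain ⟨a, ha⟩ := hg.eq_on
  obtain ⟨ψ, hψ, hψS, h1, h2⟩ := h.exists_annulus_of_pos hg hpos
  have hlt : ∀ x ∈ S, g x < Real.pi := fun x hx ↦ hg.lt_pi h.isPreconnected h.sin_ne hx
  set c := g p with hc
  have hc0 : 0 < c := hpos p hp
  have hcπ : c < Real.pi := hlt p hp
  have hLS : {x | g x = c} ⊆ S := fun x (hx : g x = c) ↦
    hg.mem_of_pos_of_lt_pi (by rwa [hx]) (by rwa [hx])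
  have hmin : ∀ x ∈ S, ¬ IsLocalMin g x := fun x hx ↦ h.not_isLocalMin hg hx
  have hmax : ∀ x ∈ S, ¬ IsLocalMin (fun y ↦ Real.pi - g y) x := fun x hx hm ↦ by
    refine h.neg.not_isLocalMin hg.neg hx ?_
    filter_upwards [hm] with y hy
    linarith
  have hA : IsPreconnected {x | x ∈ S ∧ g x < c} :=
    isPreconnected_sublevel_of_annulus h.isOpen h.isBounded hψ hψS hgc hc0 hpos
      (fun x _ hx0 hxc ↦ hg.mem_of_pos_of_lt_pi hx0 (hxc.trans hcπ)) hmin h1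
      (fun z ↦ by rw [h2]; exact hπ)
  -- The part above `c` is the sublevel part of `π - g`, which vanishes at the other end of the
  -- annulus.
  have hB : IsPreconnected {x | x ∈ S ∧ Real.pi - g x < Real.pi - c} :=
    isPreconnected_sublevel_of_annulus h.isOpen h.isBounded (continuousOn_annulus_flip hψ)
      ((image_annulus_flip ψ).trans hψS) (f := fun y ↦ Real.pi - g y) (by fun_prop)
      (sub_pos.2 hcπ) (fun x hx ↦ sub_pos.2 (hlt x hx))
      (fun x _ hx0 hxc ↦ hg.mem_of_pos_of_lt_pi (by linarith) (by linarith)) hmax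
      (fun z ↦ by simp only [h2, sub_self]) (fun z ↦ by simp only [neg_neg, h1, sub_zero]; exact hπ)
  have hbdd : Bornology.IsBounded {x | g x = c} := h.isBounded.subset hLS
  have hLB : {x | g x = c} ⊆ closure {x | x ∈ S ∧ Real.pi - g x < Real.pi - c} := by
    have hset : {x | g x = c} = {x | Real.pi - g x = Real.pi - c} := by
      ext x; simp only [mem_ofPred_eq, sub_right_inj]
    rw [hset]
    exact level_subset_closure_sublevel h.isOpen (by rwa [← hset]) hmax
  have hL : IsPreconnected {x | g x = c} :=
    isPreconnected_level_of_closure hgc hbdd hA (fun x hx ↦ hx.2)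
      (level_subset_closure_sublevel h.isOpen hLS hmin) hB
      (fun x hx ↦ (sub_lt_sub_iff_left _).1 hx.2) hLB
  have hcurve : levelCurve Ω θ p = {x | g x = c} := by
    refine Subset.antisymm (fun q hq ↦ ?_) ?_
    · have hsub := connectedComponentIn_subset {q | q ∈ Ω ∧ θ q = θ p} p
      have hpp : p ∈ levelCurve Ω θ p := mem_connectedComponentIn ⟨h.subset hp, rfl⟩
      have hqS : q ∈ S := h.subset_of_isPreconnected _ isPreconnected_connectedComponentIn
        (fun x hx ↦ ⟨(hsub hx).1, by rw [(hsub hx).2]; exact h.sin_ne p hp⟩) ⟨p, hpp, hp⟩ hq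
      change g q = c
      rw [hc, ha q hqS, ha p hp, (hsub hq).2]
    · refine hL.subset_connectedComponentIn (show g p = c from rfl) fun x hx ↦
        ⟨h.subset (hLS hx), ?_⟩
      have e1 := ha x (hLS hx)
      have e2 := ha p hp
      have e3 : g x = g p := hx
      linarith
  have hS : S ∈ 𝓝 p := h.isOpen.mem_nhds hp
  refine _root_.inducedOrientation_eq_one (h.isRegularPoint p hp) ?_ ?_ ?_
  · filter_upwards [hS] with q hq hqp
    rw [hcurve]
    change g q = c
    rw [hc, ha q hq, ha p hp, hqp]
  · filter_upwards [hS] with q hq hqp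
    rw [hcurve]
    refine mem_insideOf_level_of_lt hgc hR hc0 ?_
    rw [hc, ha q hq, ha p hp]; linarith
  · filter_upwards [hS] with q hq hqp
    rw [hcurve]
    refine notMem_insideOf_level_of_lt hgc hR hc0 rfl h.isOpen hLS hA hq ?_
    rw [hc, ha q hq, ha p hp]; linarith

theorem inducedOrientation_eq_neg_one (h : IsStrip Ω S θ) (hg : IsStripPotential S θ g)
    (hneg : ∀ x ∈ S, g x < 0) {p : Plane} (hp : p ∈ S) : inducedOrientation Ω θ p = -1 := by
  have := h.neg.inducedOrientation_eq_one hg.neg (fun x hx ↦ neg_pos.2 (hneg x hx)) hp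
  rw [inducedOrientation_neg] at this
  omega

end IsStrip

/-! ### Strips of a phase function and their finiteness -/

theorem mem_sdiff_phaseZeroSet {Ω : Set Plane} {θ : Plane → ℝ} {x : Plane} :
    x ∈ Ω \ phaseZeroSet Ω θ ↔ x ∈ Ω ∧ Real.sin (θ x) ≠ 0 :=
  ⟨fun h ↦ ⟨h.1, fun h0 ↦ h.2 ⟨subset_closure h.1, h0⟩⟩, fun h ↦ ⟨h.1, fun h0 ↦ h.2 h0.2⟩⟩

namespace IsPhaseFunction

variable {Ω S : Set Plane} {θ : Plane → ℝ}

theorem isOpen_sdiff (hθ : IsPhaseFunction Ω θ) (hΩ : IsOpen Ω) :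
    IsOpen (Ω \ phaseZeroSet Ω θ) := by
  obtain ⟨K, hK⟩ := hθ.lipschitz
  have hset : Ω \ phaseZeroSet Ω θ = Ω ∩ (Real.sin ∘ θ) ⁻¹' {0}ᶜ :=
    Set.ext fun x ↦ mem_sdiff_phaseZeroSet
  rw [hset]
  exact (Real.continuous_sin.comp_continuousOn
    (hK.continuousOn.mono subset_closure)).isOpen_inter_preimage hΩ isOpen_compl_singleton

theorem isRegularPoint (hθ : IsPhaseFunction Ω θ) (hΩ : IsOpen Ω) {x : Plane} (hx : x ∈ Ω)
    (hsin : Real.sin (θ x) ≠ 0) : IsRegularPoint θ x := by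
  obtain ⟨K, hK⟩ := hθ.lipschitz
  obtain ⟨F, -, hcos, hdef⟩ := hθ.foliation
  have hxF : x ∈ ⋃ e ∈ F.charts, e.source := by
    rw [F.cover]
    exact ⟨hx, fun hxd ↦ hsin (hdef hxd).2⟩
  simp only [mem_iUnion] at hxF
  obtain ⟨e, he, hxe⟩ := hxF
  exact isRegularPoint_of_chart
    (hK.continuousOn.continuousAt (mem_of_superset (hΩ.mem_nhds hx) subset_closure)) hsin e
    (F.smooth e he) (F.smooth_symm e he) hxe (hcos e he)

theorem isStrip (hθ : IsPhaseFunction Ω θ) (hΩ : IsOpen Ω) (hΩb : Bornology.IsBounded Ω)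
    (hbc : DirichletCondition Ω θ) (hS : S ∈ phaseStrips Ω θ) : IsStrip Ω S θ := by
  obtain ⟨K, hK⟩ := hθ.lipschitz
  obtain ⟨Φ, ψ, ⟨L, hL⟩, hΦ, h1, h2⟩ := hθ.annular S hS
  have hann : ψ '' (univ ×ˢ Ioo (-1) 1) = S := by
    ext x
    constructor
    · rintro ⟨⟨z, t⟩, ⟨-, ht⟩, rfl⟩
      rw [hΦ z ⟨t, ht⟩]
      exact (Φ (z, ⟨t, ht⟩)).2
    · intro hx
      obtain ⟨⟨z, t⟩, hzt⟩ := Φ.surjective ⟨x, hx⟩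
      exact ⟨(z, t), ⟨mem_univ _, t.2⟩, by rw [hΦ z t, hzt]⟩
  obtain ⟨p, hp, rfl⟩ := hS
  have hsub := connectedComponentIn_subset (Ω \ phaseZeroSet Ω θ) p
  have hsubΩ : connectedComponentIn (Ω \ phaseZeroSet Ω θ) p ⊆ Ω := fun x hx ↦ (hsub hx).1
  refine
  { isOpen := (hθ.isOpen_sdiff hΩ).connectedComponentIn
    isPreconnected := isPreconnected_connectedComponentIn
    isBounded := hΩb.subset hsubΩ
    nonempty := ⟨p, mem_connectedComponentIn hp⟩
    subset := hsubΩ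
    sin_ne := fun x hx ↦ (mem_sdiff_phaseZeroSet.1 (hsub hx)).2
    subset_of_isPreconnected := fun T hT hTΩ ⟨x, hxT, hxS⟩ ↦ ?_
    continuousOn := hK.continuousOn.mono (closure_mono hsubΩ)
    sin_eq := fun x hx ↦ ?_
    isRegularPoint := fun x hx ↦
      hθ.isRegularPoint hΩ (hsubΩ hx) (mem_sdiff_phaseZeroSet.1 (hsub hx)).2
    exists_annulus := ⟨ψ, hL.continuousOn, hann, fun z ↦ (h1 z).2, fun z ↦ (h2 z).2⟩ }
  · rw [connectedComponentIn_eq hxS]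
    exact hT.subset_connectedComponentIn hxT fun y hy ↦ mem_sdiff_phaseZeroSet.2 (hTΩ y hy)
  -- A frontier point of the strip is either on `frontier Ω`, where `θ = 0`, or in `Ω`; there `sin θ
  -- ≠ 0` would put it into the open component itself.
  · by_contra hne
    have hxcl : x ∈ closure Ω := closure_mono hsubΩ hx.1
    have hxΩ : x ∈ Ω := by
      by_contra hxn
      refine hne ?_
      rw [hbc x (hΩ.frontier_eq ▸ ⟨hxcl, hxn⟩), Real.sin_zero]
    have hmem : x ∈ connectedComponentIn (Ω \ phaseZeroSet Ω θ) p :=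
      mem_connectedComponentIn_of_mem_closure hx.1 (mem_sdiff_phaseZeroSet.2 ⟨hxΩ, hne⟩)
    exact ((hθ.isOpen_sdiff hΩ).connectedComponentIn.frontier_eq ▸ hx).2 hmem

theorem finite_phaseStrips (hθ : IsPhaseFunction Ω θ) (hΩ : IsOpen Ω)
    (hΩb : Bornology.IsBounded Ω) (hbc : DirichletCondition Ω θ) : (phaseStrips Ω θ).Finite := by
  obtain ⟨K, hK⟩ := hθ.lipschitz
  have hπ := Real.pi_pos
  -- Within distance `r`, `θ` changes by less than `π / 2`; the `+ 1` covers `K = 0`. Across the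
  -- annulus `cos θ` runs from `-1` to `1`, so it vanishes somewhere in the strip; the ball of
  -- radius `r` there misses `sin θ = 0`, hence also `frontier Ω`.
  set r : ℝ := Real.pi / (2 * (K + 1)) with hr
  have hr0 : 0 < r := by positivity
  have hKr : K * r < Real.pi / 2 := by
    have hK0 : (0 : ℝ) < K + 1 := by positivity
    have : (K + 1 : ℝ) * r = Real.pi / 2 := by rw [hr]; field_simp
    linarith
  have hball : ∀ S ∈ phaseStrips Ω θ, ∃ x, Metric.ball x r ⊆ S := by
    intro S hS
    have h := hθ.isStrip hΩ hΩb hbc hS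
    obtain ⟨Φ, ψ, ⟨L, hL⟩, hΦ, h1, h2⟩ := hθ.annular S hS
    have hψΩ : ∀ t ∈ Icc (-1 : ℝ) 1, ψ (1, t) ∈ closure Ω := by
      rintro t ⟨ht1, ht2⟩
      rcases ht1.eq_or_lt with rfl | ht1
      · exact (h2 1).1
      rcases ht2.eq_or_lt with rfl | ht2
      · exact (h1 1).1
      · rw [hΦ 1 ⟨t, ht1, ht2⟩]
        exact subset_closure (h.subset (Φ (1, ⟨t, ht1, ht2⟩)).2)
    have hcont : ContinuousOn (fun t : ℝ ↦ Real.cos (θ (ψ (1, t)))) (Icc (-1) 1) := by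
      refine Real.continuous_cos.comp_continuousOn (hK.continuousOn.comp ?_ hψΩ)
      exact hL.continuousOn.comp (by fun_prop) fun t ht ↦ ⟨mem_univ _, ht⟩
    obtain ⟨t, ht, htc⟩ := intermediate_value_Icc (by norm_num) hcont
      (show (0 : ℝ) ∈ Icc _ _ by
        constructor
        · rw [(h2 1).2]; norm_num
        · rw [(h1 1).2]; norm_num)
    simp only at htc
    have ht1 : t ≠ -1 := by rintro rfl; rw [(h2 1).2] at htc; norm_num at htc
    have ht2 : t ≠ 1 := by rintro rfl; rw [(h1 1).2] at htc; norm_num at htc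
    have ht' : t ∈ Ioo (-1 : ℝ) 1 := ⟨lt_of_le_of_ne ht.1 ht1.symm, lt_of_le_of_ne ht.2 ht2⟩
    set x := ψ (1, t) with hx
    have hxS : x ∈ S := by rw [hx, hΦ 1 ⟨t, ht'⟩]; exact (Φ (1, ⟨t, ht'⟩)).2
    have hsin : ∀ y ∈ Metric.ball x r, y ∈ closure Ω → Real.sin (θ y) ≠ 0 := by
      intro y hy hyΩ hsin
      have h3 : |θ y - θ x| < Real.pi / 2 := by
        have h4 := hK.dist_le_mul y hyΩ x (subset_closure (h.subset hxS))
        rw [Real.dist_eq] at h4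
        have h5 : (K : ℝ) * dist y x ≤ K * r := by
          gcongr; exact (Metric.mem_ball.1 hy).le
        linarith
      have h6 : Real.cos (θ y - θ x) = 0 := by rw [Real.cos_sub, hsin, htc]; ring
      rw [abs_lt] at h3
      exact (Real.cos_pos_of_mem_Ioo ⟨h3.1, h3.2⟩).ne' h6
    have hxb : x ∈ Metric.ball x r := Metric.mem_ball_self hr0
    have hbΩ : Metric.ball x r ⊆ Ω := by
      by_contra hnot
      obtain ⟨y, hy, hyΩ⟩ := not_subset.1 hnot
      obtain ⟨w, hw, hwf⟩ := (convex_ball x r).isPreconnected.inter_frontier_nonempty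
        ⟨x, hxb, h.subset hxS⟩ ⟨y, hy, hyΩ⟩
      refine hsin w hw hwf.1 ?_
      rw [hbc w hwf, Real.sin_zero]
    exact ⟨x, h.subset_of_isPreconnected _ (convex_ball x r).isPreconnected
      (fun y hy ↦ ⟨hbΩ hy, hsin y hy (subset_closure (hbΩ hy))⟩) ⟨x, hxb, hxS⟩⟩
  choose! x hx using hball
  have hsep : ∀ S ∈ phaseStrips Ω θ, ∀ T ∈ phaseStrips Ω θ, dist (x S) (x T) < r → S = T := by
    intro S hS T hT hd
    have hxS : x S ∈ S := hx S hS (Metric.mem_ball_self hr0)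
    have hxT : x S ∈ T := hx T hT hd
    have h1 := hθ.isStrip hΩ hΩb hbc hS
    have h2 := hθ.isStrip hΩ hΩb hbc hT
    refine Subset.antisymm ?_ ?_
    · exact h2.subset_of_isPreconnected S h1.isPreconnected
        (fun y hy ↦ ⟨h1.subset hy, h1.sin_ne y hy⟩) ⟨_, hxS, hxT⟩
    · exact h1.subset_of_isPreconnected T h2.isPreconnected
        (fun y hy ↦ ⟨h2.subset hy, h2.sin_ne y hy⟩) ⟨_, hxT, hxS⟩
  obtain ⟨t, -, htf, ht⟩ := (hΩb.isCompact_closure.finite_cover_balls (e := r / 2) (by positivity))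
  have hmem : ∀ S ∈ phaseStrips Ω θ, ∃ y ∈ t, x S ∈ Metric.ball y (r / 2) := by
    intro S hS
    have h1 := hθ.isStrip hΩ hΩb hbc hS
    have h2 := ht (subset_closure (h1.subset (hx S hS (Metric.mem_ball_self hr0))))
    simpa only [mem_iUnion, exists_prop] using h2
  choose! y hyt hy using hmem
  refine Set.Finite.of_finite_image (f := y) (htf.subset (image_subset_iff.2 hyt)) ?_
  intro S hS T hT hST
  refine hsep S hS T hT ?_
  have e1 := hy S hS
  have e2 := hy T hT
  rw [← hST] at e2
  rw [Metric.mem_ball] at e1 e2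
  linarith [dist_triangle_right (x S) (x T) (y S)]

end IsPhaseFunction

/-! ### Flipping strips by a gauge change -/

theorem exists_sum_add_self_eq_int_mul_two_pi {ι : Type*} (P : Finset ι) {f : ι → ℝ}
    (hf : ∀ i ∈ P, ∃ n : ℤ, f i = n * Real.pi) :
    ∃ m : ℤ, ∑ i ∈ P, (f i + f i) = m * (2 * Real.pi) := by
  refine Finset.sum_induction _ (fun r ↦ ∃ m : ℤ, r = m * (2 * Real.pi)) ?_ ⟨0, by simp⟩ ?_
  · rintro _ _ ⟨m, rfl⟩ ⟨n, rfl⟩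
    exact ⟨m + n, by push_cast; ring⟩
  · intro i hi
    obtain ⟨n, hn⟩ := hf i hi
    exact ⟨n, by rw [hn]; ring⟩

theorem exists_lipschitzWith_sum_add_self {ι X : Type*} [PseudoMetricSpace X] (P : Finset ι)
    {f : ι → X → ℝ} (hf : ∀ i ∈ P, ∃ K, LipschitzWith K (f i)) :
    ∃ K, LipschitzWith K fun x ↦ ∑ i ∈ P, (f i x + f i x) := by
  classical
  induction P using Finset.induction_on with
  | empty => exact ⟨0, by simp⟩
  | insert i P hi ih =>
    obtain ⟨K, hK⟩ := hf i (Finset.mem_insert_self i P)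
    obtain ⟨L, hL⟩ := ih fun j hj ↦ hf j (Finset.mem_insert_of_mem hj)
    refine ⟨K + K + L, ?_⟩
    simp only [Finset.sum_insert hi]
    exact (hK.add hK).add hL

namespace GaugeEquivalent

variable {Ω : Set Plane} {θ θ' : Plane → ℝ}

theorem phaseZeroSet_eq (h : GaugeEquivalent Ω θ' θ) :
    phaseZeroSet Ω θ' = phaseZeroSet Ω θ := by
  ext x
  refine and_congr_right fun hx ↦ ?_
  rw [Real.sin_eq_zero_iff_cos_eq, Real.sin_eq_zero_iff_cos_eq, h x hx]

theorem phaseStrips_eq (h : GaugeEquivalent Ω θ' θ) : phaseStrips Ω θ' = phaseStrips Ω θ := by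
  rw [phaseStrips, phaseStrips, h.phaseZeroSet_eq]

/-- Apart from the Lipschitz bound, being a phase function depends on `θ` only through `cos θ`, so
the same foliation and annuli serve. -/
theorem isPhaseFunction (h : GaugeEquivalent Ω θ' θ) (hθ : IsPhaseFunction Ω θ)
    (hlip : ∃ K : NNReal, LipschitzOnWith K θ' (closure Ω)) : IsPhaseFunction Ω θ' where
  lipschitz := hlip
  foliation := by
    obtain ⟨F, hF, hcos, hdef⟩ := hθ.foliation
    refine ⟨F, hF, fun e he p hp ↦ ?_, by rwa [h.phaseZeroSet_eq]⟩
    have hpΩ : p ∈ Ω \ (F.defects : Set Plane) := F.cover ▸ mem_biUnion he hp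
    rw [hcos e he p hp, h p (subset_closure hpΩ.1)]
  annular S hS := by
    rw [h.phaseStrips_eq] at hS
    obtain ⟨Φ, ψ, hL, hΦ, h1, h2⟩ := hθ.annular S hS
    exact ⟨Φ, ψ, hL, hΦ, fun z ↦ ⟨(h1 z).1, by rw [h _ (h1 z).1, (h1 z).2]⟩,
      fun z ↦ ⟨(h2 z).1, by rw [h _ (h2 z).1, (h2 z).2]⟩⟩

end GaugeEquivalent

theorem phaseStrips_eq_of_mem_of_mem {Ω S T : Set Plane} {θ : Plane → ℝ} {x : Plane}
    (hS : S ∈ phaseStrips Ω θ) (hT : T ∈ phaseStrips Ω θ) (hxS : x ∈ S) (hxT : x ∈ T) : S = T := by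
  obtain ⟨p, hp, rfl⟩ := hS
  obtain ⟨q, hq, rfl⟩ := hT
  rw [connectedComponentIn_eq hxS, connectedComponentIn_eq hxT]

/-- Every choice of orientations of the strips is induced by a gauge-equivalent phase function. -/
theorem IsPhaseFunction.exists_inducedOrientation_eq {Ω : Set Plane} (hΩ : IsOpen Ω)
    (hΩb : Bornology.IsBounded Ω) (hΩsc : IsSimplyConnected Ω) {θ : Plane → ℝ}
    (hθ : IsPhaseFunction Ω θ) (hbc : DirichletCondition Ω θ) (ε : Set Plane → ℤˣ) :
    ∃ θ' : Plane → ℝ, IsPhaseFunction Ω θ' ∧ GaugeEquivalent Ω θ' θ ∧ DirichletCondition Ω θ' ∧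
      ∀ S ∈ phaseStrips Ω θ, ∀ p ∈ S, inducedOrientation Ω θ' p = (ε S : ℤ) := by
  classical
  have hstrip : ∀ S ∈ phaseStrips Ω θ, IsStrip Ω S θ := fun S hS ↦ hθ.isStrip hΩ hΩb hbc hS
  have hex : ∀ S ∈ phaseStrips Ω θ, ∃ g, IsStripPotential S θ g := fun S hS ↦
    exists_isStripPotential (hstrip S hS).isPreconnected (hstrip S hS).isBounded
      (hstrip S hS).continuousOn (hstrip S hS).sin_eq
  choose! g hg using hex
  obtain ⟨K, hK⟩ := hθ.lipschitz
  have hfin := hθ.finite_phaseStrips hΩ hΩb hbc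
  -- The strips whose orientation disagrees with `ε`. Since `g S` has constant sign on `S`, one
  -- point is enough to detect this.
  set P : Finset (Set Plane) :=
    hfin.toFinset.filter fun S ↦ ∃ p ∈ S, ((ε S : ℤ) : ℝ) * g S p < 0 with hP
  have hPS : ∀ S ∈ P, S ∈ phaseStrips Ω θ := fun S hS ↦
    hfin.mem_toFinset.1 (Finset.mem_filter.1 hS).1
  -- On a strip in `P`, where `g S = θ - aπ`, the term of that strip turns `θ` into `-θ + 2aπ`; all
  -- other terms are constant multiples of `2π` there.
  set θ' : Plane → ℝ := fun x ↦ θ x - ∑ S ∈ P, (g S x + g S x) with hθ'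
  have hout : ∀ x ∉ Ω, ∀ S ∈ phaseStrips Ω θ, g S x = 0 := fun x hx S hS ↦ by
    obtain ⟨R, hR⟩ := (hg S hS).eventually_zero
    exact eq_zero_of_notMem_of_isSimplyConnected hΩ hΩsc (hg S hS).continuous hR
      (fun y hy ↦ (hg S hS).exists_int_of_notMem y fun h ↦ hy ((hstrip S hS).subset h)) hx
  have hother : ∀ S₀ ∈ phaseStrips Ω θ, ∀ x ∈ S₀, ∃ m : ℤ,
      ∑ S ∈ P.erase S₀, (g S x + g S x) = m * (2 * Real.pi) := fun S₀ hS₀ x hx ↦ by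
    refine exists_sum_add_self_eq_int_mul_two_pi _ fun S hS ↦ ?_
    rw [Finset.mem_erase] at hS
    exact (hg S (hPS S hS.2)).exists_int_of_notMem x fun h ↦
      hS.1 (phaseStrips_eq_of_mem_of_mem (hPS S hS.2) hS₀ h hx)
  have hconst : ∀ S₀ ∈ phaseStrips Ω θ, ∃ m : ℤ, ∀ x ∈ S₀,
      ∑ S ∈ P.erase S₀, (g S x + g S x) = m * (2 * Real.pi) := fun S₀ hS₀ ↦ by
    obtain ⟨p, hp⟩ := (hstrip S₀ hS₀).nonempty
    obtain ⟨m, hm⟩ := hother S₀ hS₀ p hp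
    refine ⟨m, fun x hx ↦ ?_⟩
    rw [← hm]
    refine (hstrip S₀ hS₀).isPreconnected.eq_of_forall_int_mul
      (f := fun y ↦ ∑ S ∈ P.erase S₀, (g S y + g S y)) (Continuous.continuousOn ?_)
      Real.two_pi_pos (hother S₀ hS₀) hx hp
    refine continuous_finsetSum _ fun S hS ↦ ?_
    have := (hg S (hPS S (Finset.mem_of_mem_erase hS))).continuous
    exact this.add this
  -- `θ'` is `θ` or `-θ` up to a multiple of `2π` on each strip
  have hflip : ∀ S ∈ P, ∃ m : ℤ, ∀ x ∈ S, θ' x = -θ x + m * (2 * Real.pi) := fun S hS ↦ by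
    obtain ⟨m, hm⟩ := hconst S (hPS S hS)
    obtain ⟨a, ha⟩ := (hg S (hPS S hS)).eq_on
    refine ⟨a - m, fun x hx ↦ ?_⟩
    simp only [hθ']
    rw [← Finset.add_sum_erase P _ hS, hm x hx, ha x hx]
    push_cast; ring
  have hkeep : ∀ S ∈ phaseStrips Ω θ, S ∉ P → ∃ m : ℤ, ∀ x ∈ S,
      θ' x = θ x + m * (2 * Real.pi) := fun S hS hSP ↦ by
    obtain ⟨m, hm⟩ := hconst S hS
    refine ⟨-m, fun x hx ↦ ?_⟩
    have := hm x hx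
    rw [Finset.erase_eq_of_notMem hSP] at this
    simp only [hθ']
    rw [this]
    push_cast; ring
  have hgauge : GaugeEquivalent Ω θ' θ := by
    intro x _
    by_cases hxP : ∃ S ∈ P, x ∈ S
    · obtain ⟨S, hS, hxS⟩ := hxP
      obtain ⟨m, hm⟩ := hflip S hS
      rw [hm x hxS, Real.cos_add_int_mul_two_pi, Real.cos_neg]
    · push Not at hxP
      obtain ⟨m, hm⟩ := exists_sum_add_self_eq_int_mul_two_pi P (f := fun S ↦ g S x) fun S hS ↦
        (hg S (hPS S hS)).exists_int_of_notMem x (hxP S hS)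
      simp only [hθ']
      rw [hm, Real.cos_sub_int_mul_two_pi]
  have hphase : IsPhaseFunction Ω θ' := by
    refine hgauge.isPhaseFunction hθ ?_
    obtain ⟨L, hL⟩ := exists_lipschitzWith_sum_add_self P (f := g) fun S hS ↦
      (hg S (hPS S hS)).exists_lipschitzWith (hstrip S (hPS S hS)).isOpen
        (hK.mono (closure_mono (hstrip S (hPS S hS)).subset))
    exact ⟨K + L, hK.sub hL.lipschitzOnWith⟩
  have hdir : DirichletCondition Ω θ' := fun x hx ↦ by
    have hxΩ : x ∉ Ω := (hΩ.frontier_eq ▸ hx).2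
    simp only [hθ']
    rw [hbc x hx, Finset.sum_eq_zero fun S hS ↦ by rw [hout x hxΩ S (hPS S hS), add_zero], sub_zero]
  refine ⟨θ', hphase, hgauge, hdir, fun S hS p hp ↦ ?_⟩
  have hst' : IsStrip Ω S θ' := hphase.isStrip hΩ hΩb hdir (hgauge.phaseStrips_eq ▸ hS)
  have hsign := (hg S hS).pos_or_neg (hstrip S hS).isPreconnected (hstrip S hS).sin_ne
  by_cases hSP : S ∈ P
  · obtain ⟨m, hm⟩ := hflip S hSP
    have hpot : IsStripPotential S θ' (fun x ↦ -g S x) :=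
      (hg S hS).neg.congr_add_int (m := 2 * m) fun x hx ↦ by rw [hm x hx]; push_cast; ring
    obtain ⟨q, hq, hneg⟩ := (Finset.mem_filter.1 hSP).2
    rcases Int.units_eq_one_or (ε S) with he | he <;> rw [he] at hneg ⊢ <;>
      simp only [Units.val_one, Units.val_neg, Int.cast_one, Int.cast_neg, one_mul, neg_mul,
        neg_lt_zero] at hneg ⊢
    · rcases hsign with h | h
      · exact absurd (h q hq) (not_lt.2 hneg.le)
      · exact hst'.inducedOrientation_eq_one hpot (fun x hx ↦ neg_pos.2 (h x hx)) hp
    · rcases hsign with h | h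
      · exact hst'.inducedOrientation_eq_neg_one hpot (fun x hx ↦ neg_lt_zero.2 (h x hx)) hp
      · exact absurd (h q hq) (not_lt.2 hneg.le)
  · obtain ⟨m, hm⟩ := hkeep S hS hSP
    have hpot : IsStripPotential S θ' (g S) :=
      (hg S hS).congr_add_int (m := 2 * m) fun x hx ↦ by rw [hm x hx]; push_cast; ring
    have hnn : ¬ ((ε S : ℤ) : ℝ) * g S p < 0 := fun h ↦
      hSP (Finset.mem_filter.2 ⟨hfin.mem_toFinset.2 hS, p, hp, h⟩)
    rcases Int.units_eq_one_or (ε S) with he | he <;> rw [he] at hnn ⊢ <;>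
      simp only [Units.val_one, Units.val_neg, Int.cast_one, Int.cast_neg, one_mul, neg_mul,
        neg_lt_zero] at hnn ⊢
    · rcases hsign with h | h
      · exact hst'.inducedOrientation_eq_one hpot h hp
      · exact absurd (h p hp) hnn
    · rcases hsign with h | h
      · exact absurd (h p hp) hnn
      · exact hst'.inducedOrientation_eq_neg_one hpot h hp

theorem theorem2p5 (Ω : Set Plane) (hΩ_open : IsOpen Ω) (hΩ_bdd : Bornology.IsBounded Ω)
    (hΩ_sc : SimplyConnectedSpace Ω) (θ : Plane → ℝ) (hθ : IsPhaseFunction Ω θ)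
    (hθ_bc : DirichletCondition Ω θ) :
    (phaseStrips Ω θ).Finite ∧
    (∀ (k : ℕ) (S : Fin k → Set Plane), Function.Injective S → Set.range S = phaseStrips Ω θ →
      ∀ ε : Fin k → ℤˣ, ∃ θ' : Plane → ℝ,
        IsPhaseFunction Ω θ' ∧ GaugeEquivalent Ω θ' θ ∧ DirichletCondition Ω θ' ∧
        ∀ i, ∀ p ∈ S i, inducedOrientation Ω θ' p = (ε i : ℤ)) ∧
    (∃ θ' : Plane → ℝ,
      IsPhaseFunction Ω θ' ∧ GaugeEquivalent Ω θ' θ ∧ DirichletCondition Ω θ' ∧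
      ∀ p ∈ Ω \ phaseZeroSet Ω θ, inducedOrientation Ω θ' p = 1) := by
  refine ⟨hθ.finite_phaseStrips hΩ_open hΩ_bdd hθ_bc, fun k S hinj hrange ε ↦ ?_, ?_⟩
  · obtain ⟨θ', h1, h2, h3, h4⟩ := hθ.exists_inducedOrientation_eq hΩ_open hΩ_bdd hΩ_sc hθ_bc
      -- Every strip is in the range of `S`, so the default value `1` is never used.
      (Function.extend S ε 1)
    refine ⟨θ', h1, h2, h3, fun i p hp ↦ ?_⟩
    rw [h4 (S i) (hrange ▸ mem_range_self i) p hp, hinj.extend_apply]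
  · obtain ⟨θ', h1, h2, h3, h4⟩ := hθ.exists_inducedOrientation_eq hΩ_open hΩ_bdd hΩ_sc hθ_bc 1
    refine ⟨θ', h1, h2, h3, fun p hp ↦ ?_⟩
    rw [h4 _ ⟨p, hp, rfl⟩ p (mem_connectedComponentIn hp)]
    rfl
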